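/- Let $J = J_1 \sqcup \dots \sqcup J_k \subset S^3$ be a $k$-component link, i.e. an oriented closed one-dimensional smooth submanifold of $S^3$ with $k$ (ordered) components. Call $J$ \emph{weakly $m$-split} if there exist $m$ pairwise disjoint compact oriented smooth surfaces $\Sigma_1,\dots,\Sigma_m$ embedded in $S^3$ (not required to be connected), each with non-empty boundary, such that $\partial\Sigma_1\sqcup\dots\sqcup\partial\Sigma_m = J$ as oriented manifolds. Let $Y_J = S^3\setminus \nu J$ be the exterior of $J$, where $\nu J$ is an open tubular neighbourhood of $J$. Let $\phi\colon \pi_1(Y_J)\to\mathbb{Z}$ be the canonical homomorphism, that is, the one that sends every oriented meridian of $J$ to $1$, and let $$r(J) := \dim_{\mathbb{Q}(t)} H_1(Y_J;\mathbb{Q}(t)),$$ where the coefficient system is given by $\pi_1(Y_J)\xrightarrow{\ \phi\ }\mathbb{Z}=\langle t\rangle\subset\mathbb{Q}(t)^{\times}$, so that every oriented meridian acts as multiplication by $t$. If $J$ is weakly $m$-split, then (the homomorphism $\phi$ exists and) $$r(J)\ \geq\ m-1.$$ -/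

import Mathlib

open scoped ContDiff

noncomputable section

namespace WeaklySplitLinks

/-- Euclidean `n`-space. -/
abbrev E (n : ℕ) : Type := EuclideanSpace ℝ (Fin n)

/-- The 3-sphere, as the unit sphere of `ℝ⁴`. It is oriented as the boundary of the unit ball:
a basis `(v₀, v₁, v₂)` of the tangent space at `x` is positive if and only if
`det (x, v₀, v₁, v₂) > 0`. -/
abbrev S3 : Type := Metric.sphere (0 : E 4) 1

/-! ### Smooth oriented coordinates on the 3-sphere -/

/-- The `j`-th coordinate vector, at the point with coordinates `p`, of a local coordinate system
`e` of the 3-sphere: the `j`-th partial derivative of the local parametrization `e.symm`. -/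
def coordVec (e : OpenPartialHomeomorph S3 (E 3)) (p : E 3) (j : Fin 3) : E 4 :=
  fderiv ℝ (fun q : E 3 => ((e.symm q : S3) : E 4)) p (EuclideanSpace.single j 1)

/-- The matrix whose rows are `x, v 0, v 1, v 2`. -/
def frameMatrix (x : E 4) (v : Fin 3 → E 4) : Matrix (Fin 4) (Fin 4) ℝ :=
  Matrix.of fun i j => (Fin.cons x v : Fin 4 → E 4) i j

/-- `e` is a smooth, orientation preserving local coordinate system of the 3-sphere. (By the
positivity of the determinant `e.symm` is an immersion, hence a diffeomorphism from the open set
`e.target` onto the open set `e.source`.) -/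
def IsPositiveChart (e : OpenPartialHomeomorph S3 (E 3)) : Prop :=
  ContDiffOn ℝ ∞ (fun q : E 3 => ((e.symm q : S3) : E 4)) e.target ∧
    ∀ p ∈ e.target, 0 < (frameMatrix (e.symm p : S3) (coordVec e p)).det

/-! ### Links -/

/-- `e` is a positive chart of the 3-sphere that is adapted to the curve `C`, oriented by the
tangent vectors `τ`: in the coordinates `e` the curve `C` is the part of the `0`-axis that lies in
`e.target`, and it is oriented in the direction of increasing `0`-th coordinate. -/
def IsCurveChart (C : Set S3) (τ : C → E 4) (e : OpenPartialHomeomorph S3 (E 3)) : Prop :=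
  IsPositiveChart e ∧
    (∀ y ∈ e.source, y ∈ C ↔ e y 1 = 0 ∧ e y 2 = 0) ∧
    ∀ y : C, (y : S3) ∈ e.source → ∃ c : ℝ, 0 < c ∧ coordVec e (e y) 0 = c • τ y

/-- A `k`-component link: an oriented closed one-dimensional smooth submanifold of the 3-sphere
with `k` connected components, which are ordered. The orientation is recorded by the positive unit
tangent vectors (which depend continuously on the point, as they come from charts). -/
structure OrientedLink (k : ℕ) where
  /-- The components. -/
  component : Fin k → Set S3
  isCompact_component : ∀ i, IsCompact (component i)
  isConnected_component : ∀ i, IsConnected (component i)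
  disjoint_component : Pairwise fun i j => Disjoint (component i) (component j)
  /-- The positive unit tangent vector at each point of the link. -/
  tangent : (⋃ i, component i : Set S3) → E 4
  norm_tangent : ∀ x, ‖tangent x‖ = 1
  exists_chart : ∀ x ∈ ⋃ i, component i, ∃ e,
    IsCurveChart (⋃ i, component i) tangent e ∧ x ∈ e.source

namespace OrientedLink

variable {k : ℕ}

/-- The underlying set of a link. -/
def carrier (J : OrientedLink k) : Set S3 := ⋃ i, J.component i

/-- Charts of the 3-sphere adapted to an oriented link. -/
def IsChart (J : OrientedLink k) (e : OpenPartialHomeomorph S3 (E 3)) : Prop :=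
  IsCurveChart J.carrier J.tangent e

end OrientedLink

/-! ### Surfaces and weakly split links -/

/-- `e` is a positive chart of the 3-sphere that is adapted to the surface with boundary `F`,
oriented by the unit normal vectors `ν`: in the coordinates `e` the surface is the part of the
half-plane `{p | p 2 = 0, 0 ≤ p 1}` that lies in `e.target`, and the normal vectors `ν` point in the
direction of increasing `2`-nd coordinate. As `e` is positive, the last condition says that
`(ν, ∂₀, ∂₁)` is a positive basis of the tangent space of the 3-sphere, that is, that `(∂₀, ∂₁)` is
a positive basis of the tangent space of the surface. -/
def IsSurfaceChart (F : Set S3) (ν : F → E 4) (e : OpenPartialHomeomorph S3 (E 3)) : Prop :=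
  IsPositiveChart e ∧
    (∀ y ∈ e.source, y ∈ F ↔ e y 2 = 0 ∧ 0 ≤ e y 1) ∧
    ∀ y : F, (y : S3) ∈ e.source →
      inner ℝ (ν y) ((y : S3) : E 4) = 0 ∧ inner ℝ (ν y) (coordVec e (e y) 0) = 0 ∧
        inner ℝ (ν y) (coordVec e (e y) 1) = 0 ∧ 0 < inner ℝ (ν y) (coordVec e (e y) 2)

/-- A compact oriented smooth surface, possibly with boundary and possibly disconnected, embedded
in the 3-sphere. The orientation is recorded by the positive unit normal vectors. -/
structure OrientedSurface where
  /-- The underlying set. -/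
  carrier : Set S3
  isCompact_carrier : IsCompact carrier
  /-- The positive unit normal vector at each point of the surface. -/
  normal : carrier → E 4
  norm_normal : ∀ x, ‖normal x‖ = 1
  exists_chart : ∀ x ∈ carrier, ∃ e, IsSurfaceChart carrier normal e ∧ x ∈ e.source

namespace OrientedSurface

/-- Charts of the 3-sphere adapted to an oriented surface. -/
def IsChart (F : OrientedSurface) (e : OpenPartialHomeomorph S3 (E 3)) : Prop :=
  IsSurfaceChart F.carrier F.normal e

/-- The boundary of the surface: the points that some adapted chart maps to the edge of the
half-plane `{p | p 2 = 0, 0 ≤ p 1}`. -/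
def boundary (F : OrientedSurface) : Set S3 :=
  {x | ∃ e, F.IsChart e ∧ x ∈ e.source ∧ e x 1 = 0 ∧ e x 2 = 0}

end OrientedSurface

/-- The link `J` is weakly `m`-split: there are `m` disjoint oriented surfaces `F i` with non-empty
boundary, such that the union of their (oriented) boundaries is `J`. At a boundary point, in a chart
adapted to `F i`, the outward direction is the direction of decreasing `1`-st coordinate; since
`(-∂₁, ∂₀)` is a positive basis of the tangent space of `F i`, the boundary orientation ("outward
vector first") is given by `∂₀`. -/
def OrientedLink.IsWeaklySplit {k : ℕ} (J : OrientedLink k) (m : ℕ) : Prop :=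
  ∃ F : Fin m → OrientedSurface,
    (Pairwise fun i j => Disjoint (F i).carrier (F j).carrier) ∧
    (∀ i, (F i).boundary.Nonempty) ∧
    (⋃ i, (F i).boundary) = J.carrier ∧
    ∀ i e, (F i).IsChart e → ∀ y : J.carrier, (y : S3) ∈ e.source →
      e y 1 = 0 → e y 2 = 0 → ∃ c : ℝ, 0 < c ∧ coordVec e (e y) 0 = c • J.tangent y

/-! ### The exterior of a link and its meridians -/

/-- A (parametrized, closed) tubular neighbourhood of the link `J`: an orientation preserving
smooth embedding `(x, v) ↦ toFun x v` of `J × {v ∈ ℝ² | ‖v‖ ≤ 1}`, which extends slightly (for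
definiteness: to `‖v‖ < 2`), with `toFun x 0 = x`. That `toFun` is a smooth orientation
preserving local diffeomorphism extending the identity of `J` is expressed as follows: near each
point of `J` it is the inverse of a chart adapted to `J`. The values for `2 ≤ ‖v‖` are irrelevant.
(The normal bundle of an oriented link in the 3-sphere is trivial, so that every tubular
neighbourhood is of this form.) -/
structure TubularNeighborhood {k : ℕ} (J : OrientedLink k) where
  /-- The parametrization. -/
  toFun : J.carrier → E 2 → S3
  injective : ∀ x y v w, ‖v‖ < 2 → ‖w‖ < 2 → toFun x v = toFun y w → x = y ∧ v = w
  exists_chart : ∀ x : J.carrier, ∃ e, J.IsChart e ∧ (x : S3) ∈ e.source ∧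
    (∃ A : Set ℝ, e.target = {p | p 0 ∈ A ∧ ‖(!₂[p 1, p 2] : E 2)‖ < 2}) ∧
    ∀ y : J.carrier, (y : S3) ∈ e.source → ∀ v : E 2, ‖v‖ < 2 →
      toFun y v = e.symm !₂[e y 0, v 0, v 1]

namespace TubularNeighborhood

variable {k : ℕ} {J : OrientedLink k}

/-- The open tubular neighbourhood: the image of `J × {v ∈ ℝ² | ‖v‖ < 1}`. -/
def openTube (N : TubularNeighborhood J) : Set S3 :=
  {z | ∃ (x : J.carrier) (v : E 2), ‖v‖ < 1 ∧ N.toFun x v = z}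

/-- The exterior of the link: the complement of the open tubular neighbourhood. -/
abbrev Exterior (N : TubularNeighborhood J) : Type := {z : S3 // z ∉ N.openTube}

/-- The point of the unit circle of `ℝ²` at angle `2πs`. -/
def circlePoint (s : ℝ) : E 2 := !₂[Real.cos (2 * Real.pi * s), Real.sin (2 * Real.pi * s)]

theorem norm_circlePoint (s : ℝ) : ‖circlePoint s‖ = 1 := by
  simp [circlePoint, EuclideanSpace.norm_eq]

theorem continuous_meridian (N : TubularNeighborhood J) (x : J.carrier) :
    Continuous fun s : unitInterval => N.toFun x (circlePoint s) := by
  obtain ⟨e, he, hx, ⟨A, hA⟩, h⟩ := N.exists_chart x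
  have hlt : ∀ s : ℝ, ‖circlePoint s‖ < 2 := fun s => by rw [norm_circlePoint]; norm_num
  have hx0 : e x 0 ∈ A := by
    have := e.map_source hx
    rw [hA] at this
    exact this.1
  have hfun : (fun s : unitInterval => N.toFun x (circlePoint s)) =
      fun s : unitInterval => e.symm !₂[e x 0, circlePoint s 0, circlePoint s 1] :=
    funext fun s => h x hx _ (hlt s)
  rw [hfun]
  refine e.continuousOn_symm.comp_continuous ?_ fun s => ?_
  · refine (PiLp.continuous_toLp 2 _).comp (continuous_pi fun i => ?_)
    fin_cases i <;> simp [circlePoint] <;> fun_prop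
  · rw [hA]
    refine ⟨by simpa using hx0, ?_⟩
    have : (!₂[(!₂[e x 0, circlePoint s 0, circlePoint s 1] : E 3) 1,
        (!₂[e x 0, circlePoint s 0, circlePoint s 1] : E 3) 2] : E 2) = circlePoint s := by
      ext i
      fin_cases i <;> simp
    rw [this]
    exact hlt s

theorem meridian_notMem (N : TubularNeighborhood J) (x : J.carrier) (s : ℝ) :
    N.toFun x (circlePoint s) ∉ N.openTube := by
  rintro ⟨y, v, hv, hxy⟩
  have h := (N.injective y x v (circlePoint s) (by linarith)
    (by rw [norm_circlePoint]; norm_num) hxy).2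
  rw [h, norm_circlePoint] at hv
  exact lt_irrefl _ hv

/-- The base point of the meridian at `x`. -/
def meridianPoint (N : TubularNeighborhood J) (x : J.carrier) : N.Exterior :=
  ⟨N.toFun x (circlePoint 0), N.meridian_notMem x 0⟩

/-- The oriented meridian of the link at `x`: the boundary circle of the fibre over `x` of the
tubular neighbourhood, run through once in the positive direction. -/
def meridian (N : TubularNeighborhood J) (x : J.carrier) :
    Path (N.meridianPoint x) (N.meridianPoint x) where
  toFun s := ⟨N.toFun x (circlePoint s), N.meridian_notMem x s⟩
  continuous_toFun := (N.continuous_meridian x).subtype_mk _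
  source' := by simp [meridianPoint]
  target' := by simp [meridianPoint, circlePoint]

end TubularNeighborhood

/-! ### Homology with twisted coefficients -/

section TwistedHomology

/-- The homology at `B` of `A → B → C`: cycles modulo boundaries. -/
abbrev Homology {K A B C : Type} [Field K] [AddCommGroup A] [AddCommGroup B] [AddCommGroup C]
    [Module K A] [Module K B] [Module K C] (f : A →ₗ[K] B) (g : B →ₗ[K] C) : Type :=
  LinearMap.ker g ⧸ (LinearMap.range f).submoduleOf (LinearMap.ker g)

variable {X : Type} [TopologicalSpace X]

/-- Singular `n`-simplices. -/
abbrev Simplex (X : Type) [TopologicalSpace X] (n : ℕ) : Type :=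
  C(stdSimplex ℝ (Fin (n + 1)), X)

/-- The simplex spanned by the vertices `f 0, …, f m` of a singular simplex. -/
def Simplex.sub {m n : ℕ} (σ : Simplex X n) (f : Fin (m + 1) → Fin (n + 1)) : Simplex X m :=
  σ.comp ⟨stdSimplex.map f, stdSimplex.continuous_map f⟩

/-- The face of a singular simplex opposite to the `i`-th vertex. -/
def Simplex.face {n : ℕ} (σ : Simplex X (n + 1)) (i : Fin (n + 2)) : Simplex X n :=
  σ.sub i.succAbove

/-- The path along the edge of a singular simplex from the `0`-th to the `1`-st vertex. -/
def Simplex.edge {n : ℕ} (σ : Simplex X (n + 1)) :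
    Path (σ.sub ![0, 1] (stdSimplex.vertex 0)) (σ.sub ![0, 1] (stdSimplex.vertex 1)) where
  toFun s := σ.sub ![0, 1] (stdSimplexHomeomorphUnitInterval.symm s)
  continuous_toFun := by fun_prop
  source' := by rw [← stdSimplexHomeomorphUnitInterval_zero, Homeomorph.symm_apply_apply]
  target' := by rw [← stdSimplexHomeomorphUnitInterval_one, Homeomorph.symm_apply_apply]

/-- A homomorphism from the fundamental groupoid of `X` to the infinite cyclic group. For
path-connected `X` it amounts, up to natural isomorphism, to a homomorphism `π₁(X) → ℤ`. -/
abbrev GroupoidHom (X : Type) [TopologicalSpace X] : Type :=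
  CategoryTheory.Functor (FundamentalGroupoid X) (CategoryTheory.SingleObj (Multiplicative ℤ))

/-- The integer that `φ` assigns to a path. -/
def GroupoidHom.eval (φ : GroupoidHom X) {x y : X} (p : Path x y) : ℤ :=
  Multiplicative.toAdd (show Multiplicative ℤ from
    φ.map (FundamentalGroupoid.fromPath (Path.Homotopic.Quotient.mk p)))

variable {K : Type} [Field K]

/-- The boundary map of the singular chain complex of `X` with coefficients in the local system
with fibre the field `K` in which the transport along a path `p` is multiplication by `t ^ φ(p)`.
The coefficient of a singular simplex lives in the fibre over its `0`-th vertex: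
`∂ σ = t ^ φ(edge of σ from vertex 0 to vertex 1) • (face 0 of σ) + ∑_{i ≥ 1} (-1)^i • (face i of σ)`.
-/
def twistedBoundary (t : Kˣ) (φ : GroupoidHom X) (n : ℕ) :
    (Simplex X (n + 1) →₀ K) →ₗ[K] (Simplex X n →₀ K) :=
  Finsupp.linearCombination K fun σ =>
    Finsupp.single (σ.face 0) ((t ^ φ.eval σ.edge : Kˣ) : K) +
      ∑ i : Fin (n + 1), Finsupp.single (σ.face i.succ) ((-1 : K) ^ (i.val + 1))

/-- The dimension (as a cardinal number) of the first homology of `X` with coefficients in this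
local system. -/
def twistedRank (t : Kˣ) (φ : GroupoidHom X) : Cardinal.{0} :=
  Module.rank K (Homology (twistedBoundary t φ 1) (twistedBoundary t φ 0))

end TwistedHomology

namespace TubularNeighborhood

variable {k : ℕ} {J : OrientedLink k}

/-- `φ` is the canonical homomorphism: it sends every oriented meridian to `1 ∈ ℤ`. -/
def IsCanonical (N : TubularNeighborhood J) (φ : GroupoidHom N.Exterior) : Prop :=
  ∀ x : J.carrier, φ.eval (N.meridian x) = 1

/-- The rank `r(J)`: the dimension over `ℚ(t)` of the first homology of the exterior of `J` with
coefficients in `ℚ(t)`, given by the canonical homomorphism `φ` (so that every oriented meridian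
acts as multiplication by `t`). -/
def linkRank (N : TubularNeighborhood J) (φ : GroupoidHom N.Exterior) : Cardinal.{0} :=
  twistedRank (Units.mk0 (RatFunc.X : RatFunc ℚ) RatFunc.X_ne_zero) φ

end TubularNeighborhood

end WeaklySplitLinks

end

/-!
Let `Y` be the exterior of a link `J` that bounds disjoint surfaces `F 0, …, F n`. Counting the
crossings of a path with the surfaces gives a homomorphism `Φ` from the fundamental groupoid of the
complement of `J` to the free group on `n + 1` generators; geometrically, it is the
Pontryagin-Thom collapse of the complement onto a wedge of circles. A meridian of `J` at a boundary
point of `F i` goes to a conjugate of the `i`-th generator. So the total exponent of `Φ` is a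
homomorphism to `ℤ` that sends each meridian to `1`, which shows that the canonical homomorphism
exists.

For the rank, let `d j` be the Fox derivatives `FreeGroup → ℤ[T, T⁻¹]`, that is, the crossed
homomorphisms with `d j (x i) = δ i j`. Their pullbacks under `Φ` are 1-cocycles with twisted
coefficients (`isTwistedCocycle_foxDerivative`). Conversely, meridians `μ i` at boundary points of
`F i` and paths `γ i` from `μ i` to `μ 0` give the twisted cycles
`z i = μ i + (t - 1) γ i - t ^ φ(γ i) μ 0` for `1 ≤ i ≤ n`. The matrix of the numbers `⟨d j, z i⟩`
with `i, j ≥ 1` comes from a matrix over `ℤ[T, T⁻¹]` which is the identity matrix at `T = 1`, where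
the Fox derivatives are exponent sums. Its determinant is therefore a non-zero Laurent polynomial,
and does not vanish at the transcendental element `t`; this proves that the rank is at least `n`
(`le_twistedRank_of_freeGroup`).

The argument needs that the given canonical homomorphism `φ` is the total exponent of `Φ`, up to a
coboundary. The quotient of the two is trivial on meridians, so it has primitives near all points
of the 3-sphere, also near those of `J`. The primitives form a principal covering of the 3-sphere,
which is trivial as the 3-sphere is simply connected; a global section is a global primitive
(`TubularNeighborhood.exists_primitive_of_meridian`).

Homomorphisms from fundamental groupoids are handled as functions on paths (`PathHom`), and are
constructed from coverings, which in turn are described by germs of transition functions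
(`IsLocalCocycle`). The covering that defines `Φ` is obtained by cutting the complement of `J` along
the surfaces (`sideCocycle`). That its monodromy along a small meridian is the `i`-th generator is a
computation of winding numbers: in a chart adapted to `F i`, the meridian is close to an ellipse
around the origin of the plane transverse to `J` (`IsCrossingHom.small_meridian`). The meridians of
the given tubular neighbourhood are not small, but under homomorphisms to commutative groups the
radius of a meridian does not matter (`IsSlabChart.exists_period`). Finally, the complement of `J`
retracts onto the exterior (`TubularNeighborhood.toExterior`).
-/

noncomputable section

open Filter Topology Set
open scoped unitInterval

namespace WeaklySplitLinks

/-! ### Local cocycles -/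

section LocalCocycle

variable {X A G : Type*} [TopologicalSpace X] [TopologicalSpace A] [Group G]

/-- A germ-wise description of a principal `G`-covering: `w x y` is only relevant for `y` near `x`,
where it is the transition from the trivialization at `x` to the one at `y`. -/
def IsLocalCocycle (w : X → X → G) : Prop :=
  ∀ x, ∀ᶠ y in 𝓝 x, ∀ᶠ z in 𝓝 y, w x z = w x y * w y z

/-- `s` is a (not necessarily continuous) global section of the covering described by `w`. -/
def IsLocalSection (w : X → X → G) (s : X → G) : Prop :=
  ∀ x, ∀ᶠ y in 𝓝 x, s y = s x * w x y

theorem IsLocalCocycle.self {w : X → X → G} (hw : IsLocalCocycle w) (x : X) : w x x = 1 := by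
  have := (hw x).self_of_nhds.self_of_nhds
  simpa using this

theorem IsLocalCocycle.comp {w : X → X → G} (hw : IsLocalCocycle w) {f : A → X}
    (hf : Continuous f) : IsLocalCocycle fun a b => w (f a) (f b) := fun a =>
  ((hf.tendsto a).eventually (hw (f a))).mono fun b hb => (hf.tendsto b).eventually hb

theorem IsLocalSection.comp {w : X → X → G} {s : X → G} (hs : IsLocalSection w s) {f : A → X}
    (hf : Continuous f) : IsLocalSection (fun a b => w (f a) (f b)) fun a => s (f a) := fun a =>
  (hf.tendsto a).eventually (hs (f a))

/-- On a preconnected space, two sections of the same covering differ by a constant. -/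
theorem IsLocalSection.inv_mul_eq [PreconnectedSpace X] {w : X → X → G} {s s' : X → G}
    (hs : IsLocalSection w s) (hs' : IsLocalSection w s') (x y : X) :
    (s x)⁻¹ * s y = (s' x)⁻¹ * s' y := by
  have h : IsLocallyConstant fun x => s' x * (s x)⁻¹ :=
    (IsLocallyConstant.iff_eventually_eq _).2 fun x => by
      filter_upwards [hs x, hs' x] with y h h'
      rw [h, h']; group
  have := h.apply_eq_of_preconnectedSpace x y
  rw [mul_inv_eq_iff_eq_mul] at this
  rw [this]; group

/-- The total space of the covering described by the local cocycle `w`. -/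
@[ext]
structure CocycleCover (w : X → X → G) where
  /-- The projection to the base. -/
  base : X
  /-- The coordinate in the fibre, with respect to the trivialization at `base`. -/
  fiber : G

/-- The local section of the covering through a point. -/
def CocycleCover.section {w : X → X → G} (e : CocycleCover w) (y : X) : CocycleCover w :=
  ⟨y, e.fiber * w e.base y⟩

variable (w : X → X → G)

/-- If `w` is a local cocycle, then the neighbourhoods of a point are the sets that contain the local
section through this point near its base. -/
instance : TopologicalSpace (CocycleCover w) :=
  TopologicalSpace.mkOfNhds fun e => map e.section (𝓝 e.base)

variable {w}

theorem IsLocalCocycle.nhds_cover (hw : IsLocalCocycle w) (e : CocycleCover w) :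
    𝓝 e = map e.section (𝓝 e.base) := by
  refine TopologicalSpace.nhds_mkOfNhds _ e ?_ ?_
  · intro e s hs
    have := mem_of_mem_nhds (mem_map.1 hs)
    simpa [hw.self, CocycleCover.section] using this
  · intro e s hs
    rw [eventually_map]
    filter_upwards [hw e.base, eventually_eventually_nhds.2 (mem_map.1 hs)] with y h1 h2
    rw [mem_map]
    filter_upwards [h1, h2] with z h3 h4
    simpa [mul_assoc, ← h3, CocycleCover.section] using h4

theorem IsLocalCocycle.isCoveringMap (hw : IsLocalCocycle w) :
    IsCoveringMap (CocycleCover.base (w := w)) := by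
  let _ : TopologicalSpace G := ⊥
  have : DiscreteTopology G := ⟨rfl⟩
  have hcont : Continuous (CocycleCover.base (w := w)) := continuous_iff_continuousAt.2 fun e => by
    rw [ContinuousAt, hw.nhds_cover e]
    exact tendsto_map'_iff.2 tendsto_id
  have hU (x : X) : ∃ U : Set X, x ∈ U ∧ IsOpen U ∧ ∀ y ∈ U, ∀ᶠ z in 𝓝 y,
      w x z = w x y * w y z := by
    obtain ⟨U, h, hU, hx⟩ := eventually_nhds_iff.1 (hw x)
    exact ⟨U, hx, hU, h⟩
  choose U hxU hUo hU using hU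
  let T (x : X) : Bundle.Trivialization G (CocycleCover.base (w := w)) :=
    { toFun := fun e => (e.base, e.fiber * (w x e.base)⁻¹)
      invFun := fun e => ⟨e.1, e.2 * w x e.1⟩
      source := CocycleCover.base ⁻¹' U x
      target := U x ×ˢ univ
      map_source' := fun e he => ⟨he, trivial⟩
      map_target' := fun e he => he.1
      left_inv' := fun e _ => CocycleCover.ext rfl (by simp)
      right_inv' := fun e _ => Prod.ext rfl (by simp)
      open_source := (hUo x).preimage hcont
      open_target := (hUo x).prod isOpen_univ
      continuousOn_toFun := fun e he => ContinuousAt.continuousWithinAt <| by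
        rw [ContinuousAt, hw.nhds_cover e]
        refine tendsto_map'_iff.2 ?_
        refine Tendsto.congr' (f₁ := fun z => (z, e.fiber * (w x e.base)⁻¹)) ?_
          ((continuous_id.prodMk continuous_const).tendsto e.base)
        filter_upwards [hU x e.base he] with z hz
        simp [hz, CocycleCover.section]
      continuousOn_invFun := fun e he => ContinuousAt.continuousWithinAt <| by
        rw [ContinuousAt, hw.nhds_cover]
        refine Tendsto.congr' ?_ (tendsto_map.comp (continuous_fst.tendsto e))
        have h2 : ∀ᶠ p : X × G in 𝓝 e, p.2 = e.2 :=
          (continuous_snd.tendsto e).eventually (p := (· = e.2)) (by simp [nhds_discrete])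
        filter_upwards [h2, (continuous_fst.tendsto e).eventually (hU x e.1 he.1)] with p hp hp'
        simp [hp, hp', mul_assoc, CocycleCover.section]
      baseSet := U x
      open_baseSet := hUo x
      source_eq := rfl
      target_eq := rfl
      proj_toFun := fun _ _ => rfl }
  exact IsCoveringMap.mk _ (fun _ => G) T hxU

/-- A covering of a simply connected space has a global section. -/
theorem IsLocalCocycle.exists_isLocalSection [SimplyConnectedSpace X] [LocallyPathConnectedSpace X]
    (hw : IsLocalCocycle w) : ∃ s : X → G, IsLocalSection w s := by
  obtain ⟨x₀⟩ : Nonempty X := inferInstance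
  obtain ⟨F, ⟨-, hF⟩, -⟩ := hw.isCoveringMap.existsUnique_continuousMap_lifts
    (ContinuousMap.id X) x₀ ⟨x₀, 1⟩ rfl
  have hF1 : ∀ x, (F x).base = x := fun x => congrFun hF x
  refine ⟨fun x => (F x).fiber, fun x => ?_⟩
  have h := F.continuous.tendsto x
  rw [hw.nhds_cover] at h
  -- the graph of the section through `F x` is a neighbourhood of `F x`
  have h' : ∀ᶠ e in map (F x).section (𝓝 (F x).base), e.fiber = (F x).fiber * w (F x).base e.base := by
    rw [eventually_map]; exact Eventually.of_forall fun _ => rfl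
  filter_upwards [h.eventually h'] with y hy
  rw [hy, hF1, hF1]

end LocalCocycle

/-! ### Homomorphisms from the fundamental groupoid to a group -/

/-- A homomorphism from the fundamental groupoid of `X` to the group `G`, as a function on paths;
`γ.trans δ` is sent to the product in the same order. -/
structure PathHom (X G : Type*) [TopologicalSpace X] [Group G] where
  /-- The value on a path. -/
  toFun : C(I, X) → G
  map_homotopic : ∀ {x y : X} (γ δ : Path x y), γ.Homotopic δ →
    toFun γ.toContinuousMap = toFun δ.toContinuousMap
  map_trans : ∀ {x y z : X} (γ : Path x y) (δ : Path y z),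
    toFun (γ.trans δ).toContinuousMap = toFun γ.toContinuousMap * toFun δ.toContinuousMap

namespace PathHom

variable {X P G H : Type*} [TopologicalSpace X] [TopologicalSpace P] [Group G] [Group H]

/-- The pullback along a continuous map. -/
def comap (ψ : PathHom X G) (f : C(P, X)) : PathHom P G where
  toFun γ := ψ.toFun (f.comp γ)
  map_homotopic γ δ h := ψ.map_homotopic (γ.map f.continuous) (δ.map f.continuous) (h.map f)
  map_trans γ δ := by
    have := ψ.map_trans (γ.map f.continuous) (δ.map f.continuous)
    rw [← Path.map_trans] at this
    exact this

/-- Composition with a group homomorphism. -/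
def mapHom (ψ : PathHom X G) (f : G →* H) : PathHom X H where
  toFun γ := f (ψ.toFun γ)
  map_homotopic γ δ h := by rw [ψ.map_homotopic γ δ h]
  map_trans γ δ := by rw [ψ.map_trans, map_mul]

/-- The quotient of two homomorphisms to a commutative group. -/
def div {G : Type*} [CommGroup G] (ψ φ : PathHom X G) : PathHom X G where
  toFun γ := ψ.toFun γ / φ.toFun γ
  map_homotopic γ δ h := by rw [ψ.map_homotopic γ δ h, φ.map_homotopic γ δ h]
  map_trans γ δ := by rw [ψ.map_trans, φ.map_trans, mul_div_mul_comm]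

/-- `k` is a primitive of `ψ` on `U`: its variation along each path in `U` is the value of `ψ`. -/
def IsPrimitiveOn (ψ : PathHom X G) (k : X → G) (U : Set X) : Prop :=
  ∀ γ : C(I, X), (∀ t, γ t ∈ U) → ψ.toFun γ = (k (γ 0))⁻¹ * k (γ 1)

theorem exists_primitive [SimplyConnectedSpace P] (ψ : PathHom P G) :
    ∃ k : P → G, ψ.IsPrimitiveOn k univ := by
  obtain ⟨p₀⟩ : Nonempty P := inferInstance
  refine ⟨fun p => ψ.toFun (PathConnectedSpace.somePath p₀ p).toContinuousMap, fun γ _ => ?_⟩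
  let γ' : Path (γ 0) (γ 1) := ⟨γ, rfl, rfl⟩
  have := ψ.map_trans (PathConnectedSpace.somePath p₀ (γ 0)) γ'
  rw [ψ.map_homotopic _ _ (SimplyConnectedSpace.paths_homotopic _
    (PathConnectedSpace.somePath p₀ (γ 1)))] at this
  simp only [this, inv_mul_cancel_left, γ']

theorem map_eq_one_of_const (ψ : PathHom X G) (x : X) : ψ.toFun (.const I x) = 1 := by
  have := ψ.map_homotopic _ _ (⟨Path.Homotopy.reflTrans (Path.refl x)⟩)
  rw [ψ.map_trans] at this
  exact mul_eq_left.1 this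

/-- The straight path from `a` to `b` in the unit interval. -/
def segment (a b : I) : Path a b where
  toFun t := ⟨(1 - t.1) * a.1 + t.1 * b.1,
    (convex_Icc (0 : ℝ) 1) a.2 b.2 (by linarith [t.2.2]) t.2.1 (by ring)⟩
  continuous_toFun := by fun_prop
  source' := by simp
  target' := by simp

theorem segment_mem_uIcc (a b t : I) : segment a b t ∈ uIcc a b := by
  have h1 := a.2; have h2 := b.2; have h3 := t.2
  simp only [segment, mem_uIcc, ← Subtype.coe_le_coe, Path.coe_mk_mk]
  rcases le_total a.1 b.1 with h | h
  · left; constructor <;> nlinarith [t.2.1, t.2.2]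
  · right; constructor <;> nlinarith [t.2.1, t.2.2]

instance : LocallyPathConnectedSpace I :=
  (isQuotientMap_projIcc (a := (0 : ℝ)) (h := zero_le_one)).locallyPathConnectedSpace

instance : ContractibleSpace I :=
  (convex_Icc (0 : ℝ) 1).contractibleSpace ⟨0, by simp⟩

/-- Being a primitive is a local property. -/
theorem isPrimitiveOn_of_locally {ψ : PathHom X G} {k : X → G} {U : Set X}
    (h : ∀ x ∈ U, ∃ V ∈ 𝓝 x, ∀ γ : C(I, X), γ 0 = x → (∀ t, γ t ∈ V ∩ U) →
      ψ.toFun γ = (k (γ 0))⁻¹ * k (γ 1)) : ψ.IsPrimitiveOn k U := by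
  intro γ hγ
  obtain ⟨f, hf⟩ := (ψ.comap γ).exists_primitive
  -- both `f` and `k ∘ γ` are primitives near each point of the interval
  have hloc : IsLocallyConstant fun t => k (γ t) * (f t)⁻¹ :=
    (IsLocallyConstant.iff_eventually_eq _).2 fun t => by
      obtain ⟨V, hV, hk⟩ := h (γ t) (hγ t)
      obtain ⟨W, hW, hWc, hWV⟩ : ∃ W ∈ 𝓝 t, W.OrdConnected ∧ W ⊆ γ ⁻¹' V := by
        obtain ⟨ε, hε, hb⟩ := Metric.mem_nhds_iff.1 (γ.continuous.continuousAt.preimage_mem_nhds hV)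
        refine ⟨_, Metric.ball_mem_nhds t hε, ?_, hb⟩
        refine ⟨fun a ha b hb' c hc => ?_⟩
        rw [Metric.mem_ball, Subtype.dist_eq, Real.dist_eq, abs_lt] at *
        have h1 : a.1 ≤ c.1 := hc.1
        have h2 : c.1 ≤ b.1 := hc.2
        constructor <;> linarith
      filter_upwards [hW] with u hu
      have h1 := hf (segment t u).toContinuousMap fun _ => trivial
      have h2 := hk (γ.comp (segment t u).toContinuousMap) (by simp) fun v =>
        ⟨hWV (hWc.uIcc_subset (mem_of_mem_nhds hW) hu (segment_mem_uIcc t u v)), hγ _⟩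
      have h3 := h1.symm.trans h2
      simp only [Path.coe_toContinuousMap, Path.source, Path.target,
        ContinuousMap.comp_apply] at h3
      rw [inv_mul_eq_iff_eq_mul] at h3
      rw [h3]; group
  have h01 := hloc.apply_eq_of_preconnectedSpace 0 1
  have hid := hf (ContinuousMap.id I) fun _ => trivial
  rw [mul_inv_eq_iff_eq_mul] at h01
  change ψ.toFun γ = _ at hid
  rw [hid, h01]; simp [mul_assoc]

/-- A covering of `X` described by a local cocycle has a monodromy homomorphism. -/
theorem exists_of_isLocalCocycle {w : X → X → G} (hw : IsLocalCocycle w) :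
    ∃ ψ : PathHom X G, ∀ (γ : C(I, X)) (s : I → G),
      IsLocalSection (fun a b => w (γ a) (γ b)) s → ψ.toFun γ = (s 0)⁻¹ * s 1 := by
  have hex (γ : C(I, X)) := (hw.comp γ.continuous).exists_isLocalSection
  choose S hS using hex
  have key (γ : C(I, X)) (s : I → G) (hs : IsLocalSection (fun a b => w (γ a) (γ b)) s) (a b : I) :
      (S γ a)⁻¹ * S γ b = (s a)⁻¹ * s b := (hS γ).inv_mul_eq hs a b
  refine ⟨⟨fun γ => (S γ 0)⁻¹ * S γ 1, ?_, ?_⟩, fun γ s hs => key γ s hs 0 1⟩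
  · rintro x y γ δ ⟨F⟩
    obtain ⟨s, hs⟩ := (hw.comp F.continuous).exists_isLocalSection
    have h0 := key γ.toContinuousMap (fun t => s (0, t)) (by
      simpa using hs.comp (f := fun t : I => ((0, t) : I × I)) (by fun_prop))
    have h1 := key δ.toContinuousMap (fun t => s (1, t)) (by
      simpa using hs.comp (f := fun t : I => ((1, t) : I × I)) (by fun_prop))
    -- on the two constant sides of the square the section is constant
    have hside (c : I) (hc : c = 0 ∨ c = 1) : s (0, c) = s (1, c) := by
      have h := hs.comp (f := fun t : I => ((t, c) : I × I)) (by fun_prop)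
      have hconst : ∀ t, F (t, c) = F (0, c) := by
        rcases hc with rfl | rfl <;> simp
      have h' : IsLocalSection (fun a b => w (F (a, c)) (F (b, c))) fun _ : I => (1 : G) :=
        fun a => Eventually.of_forall fun b => by
          simp only [hconst a, hconst b, hw.self, mul_one]
      have := h.inv_mul_eq h' 0 1
      simp only [inv_one, mul_one] at this
      exact (inv_mul_eq_one.1 this)
    simp only [h0, h1, hside 0 (.inl rfl), hside 1 (.inr rfl)]
  · intro x y z γ δ
    let s := S (γ.trans δ).toContinuousMap
    have hs : IsLocalSection _ s := hS (γ.trans δ).toContinuousMap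
    let l : I → I := fun t => ⟨t / 2, by constructor <;> linarith [t.2.1, t.2.2]⟩
    let r : I → I := fun t => ⟨(t + 1) / 2, by constructor <;> linarith [t.2.1, t.2.2]⟩
    have hl : ∀ t, (γ.trans δ) (l t) = γ t := fun t => by
      have ht : (t : ℝ) / 2 ≤ 1 / 2 := by linarith [t.2.2]
      rw [Path.trans_apply, dif_pos ht]
      congr 1; ext; simp [l]; ring
    have hr : ∀ t, (γ.trans δ) (r t) = δ t := fun t => by
      rw [Path.trans_apply]
      split_ifs with ht
      · have ht0 : t = 0 := by
          ext
          have := t.2.1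
          simp only [r] at ht
          change (t : ℝ) = 0; linarith
        subst ht0
        have : (⟨2 * (r 0 : ℝ), by simp [r]⟩ : I) = 1 := by ext; simp [r]
        simp [this]
      · congr 1; ext; simp [r]; ring
    have h0 := key γ.toContinuousMap (fun t => s (l t)) (by
      have h := hs.comp (f := l) (by fun_prop)
      simp only [Path.coe_toContinuousMap, hl] at h
      exact h) 0 1
    have h1 := key δ.toContinuousMap (fun t => s (r t)) (by
      have h := hs.comp (f := r) (by fun_prop)
      simp only [Path.coe_toContinuousMap, hr] at h
      exact h) 0 1
    simp only [h0, h1]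
    have e0 : l 0 = 0 := by ext; simp [l]
    have e1 : l 1 = r 0 := by ext; simp [l, r]
    have e2 : r 1 = 1 := by ext; simp [r]
    rw [e0, e1, e2]
    simp [s, mul_assoc]

theorem exists_isPrimitiveOn (ψ : PathHom X G) {U : Set X} (hU : IsSimplyConnected U) :
    ∃ k, ψ.IsPrimitiveOn k U := by
  classical
  have := hU.simplyConnectedSpace
  obtain ⟨k, hk⟩ := (ψ.comap ⟨((↑) : U → X), continuous_subtype_val⟩).exists_primitive
  refine ⟨fun x => if h : x ∈ U then k ⟨x, h⟩ else 1, fun γ hγ => ?_⟩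
  have := hk ⟨fun t => ⟨γ t, hγ t⟩, by fun_prop⟩ fun _ => trivial
  simp only [hγ, dif_pos]
  exact this

/-- A form of the Seifert-van Kampen theorem. -/
theorem exists_primitive_of_union (ψ : PathHom X G) {U V : Set X} (hUo : IsOpen U) (hVo : IsOpen V)
    (hUV : U ∪ V = univ) (hU : IsSimplyConnected U) (hV : IsSimplyConnected V)
    (hc : IsPathConnected (U ∩ V)) : ∃ k, ψ.IsPrimitiveOn k univ := by
  classical
  obtain ⟨k, hk⟩ := ψ.exists_isPrimitiveOn hU
  obtain ⟨l, hl⟩ := ψ.exists_isPrimitiveOn hV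
  obtain ⟨p, hp, hpc⟩ := hc
  -- normalize `l` to agree with `k` on the intersection
  have hkl : ∀ x ∈ U ∩ V, k x = k p * (l p)⁻¹ * l x := fun x hx => by
    obtain ⟨γ, hγ⟩ := hpc hx
    have h1 := (hk γ.toContinuousMap fun t => (hγ t).1).symm.trans
      (hl γ.toContinuousMap fun t => (hγ t).2)
    simp only [Path.coe_toContinuousMap, Path.source, Path.target] at h1
    rw [inv_mul_eq_iff_eq_mul] at h1
    rw [h1, mul_assoc]
  refine ⟨fun x => if x ∈ U then k x else k p * (l p)⁻¹ * l x,
    isPrimitiveOn_of_locally fun x _ => ?_⟩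
  rcases (hUV.symm ▸ mem_univ x : x ∈ U ∪ V) with hx | hx
  · refine ⟨U, hUo.mem_nhds hx, fun γ _ hγ => ?_⟩
    rw [if_pos (hγ 0).1, if_pos (hγ 1).1]
    exact hk γ fun t => (hγ t).1
  · refine ⟨V, hVo.mem_nhds hx, fun γ _ hγ => ?_⟩
    have h (t : I) : (if γ t ∈ U then k (γ t) else k p * (l p)⁻¹ * l (γ t)) =
        k p * (l p)⁻¹ * l (γ t) := by
      split_ifs with ht
      exacts [hkl _ ⟨ht, (hγ t).1⟩, rfl]
    rw [h, h, hl γ fun t => (hγ t).1]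
    group

/-- If all homomorphisms from the fundamental groupoid to `G` have primitives, then so do all
local cocycles. -/
theorem _root_.WeaklySplitLinks.IsLocalCocycle.exists_isLocalSection_of_primitive
    [LocallyPathConnectedSpace X] (h : ∀ ψ : PathHom X G, ∃ k, ψ.IsPrimitiveOn k univ)
    {w : X → X → G} (hw : IsLocalCocycle w) : ∃ s : X → G, IsLocalSection w s := by
  obtain ⟨ψ, hψ⟩ := exists_of_isLocalCocycle hw
  obtain ⟨k, hk⟩ := h ψ
  refine ⟨k, fun x => ?_⟩
  obtain ⟨V, ⟨hV, hVc⟩, hVw⟩ := (path_connected_basis x).mem_iff.1 (hw x)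
  filter_upwards [hV] with y hy
  obtain ⟨γ, hγ⟩ := hVc.joinedIn x (mem_of_mem_nhds hV) y hy
  have h1 := hψ γ.toContinuousMap (fun t => w x (γ t)) fun t =>
    (γ.continuous.tendsto t).eventually (hVw (hγ t))
  rw [hk _ fun _ => trivial] at h1
  simp only [Path.coe_toContinuousMap, Path.source, Path.target, hw.self, inv_one, one_mul] at h1
  rw [← h1, mul_inv_cancel_left]

end PathHom

/-! ### The 3-sphere -/

instance : Fact (Module.finrank ℝ (E 4) = 3 + 1) := ⟨by simp⟩

instance : LocallyPathConnectedSpace S3 := ChartedSpace.locallyPathConnectedSpace (E 3) S3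

theorem isSimplyConnected_compl_singleton (v : S3) : IsSimplyConnected ({v}ᶜ : Set S3) := by
  have e := (stereographic' 3 v).toHomeomorphSourceTarget
  rw [stereographic'_source, stereographic'_target] at e
  have : SimplyConnectedSpace (univ : Set (E 3)) :=
    (Homeomorph.Set.univ (E 3)).toHomotopyEquiv.simplyConnectedSpace
  exact e.toHomotopyEquiv.simplyConnectedSpace

theorem isPathConnected_compl_pair {v w : S3} (h : w ≠ v) :
    IsPathConnected ({v}ᶜ ∩ {w}ᶜ : Set S3) := by
  let e := stereographic' 3 v
  have hs : e.source = {v}ᶜ := stereographic'_source v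
  have ht : e.target = univ := stereographic'_target v
  have hc : IsPathConnected ({e w}ᶜ : Set (E 3)) :=
    isPathConnected_compl_singleton_of_one_lt_rank (by
      rw [rank_eq_card_basis (EuclideanSpace.basisFun (Fin 3) ℝ).toBasis]; simp) _
  have hi := hc.image' (f := e.symm) (e.continuousOn_symm.mono (by simp [ht]))
  convert hi using 1
  ext x
  simp only [mem_inter_iff, mem_compl_iff, mem_singleton_iff, mem_image]
  have hw : w ∈ e.source := by rw [hs]; exact h
  constructor
  · rintro ⟨h1, h2⟩
    have hx : x ∈ e.source := by rw [hs]; exact h1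
    exact ⟨e x, fun h3 => h2 (e.injOn hx hw h3), e.left_inv hx⟩
  · rintro ⟨p, hp, rfl⟩
    have hp' : p ∈ e.target := by simp [ht]
    have h1 := e.map_target hp'
    rw [hs] at h1
    exact ⟨h1, fun h2 => hp (by rw [← h2, e.right_inv hp'])⟩

theorem S3.exists_primitive {G : Type*} [Group G] (ψ : PathHom S3 G) :
    ∃ k, ψ.IsPrimitiveOn k univ := by
  let v : S3 := ⟨EuclideanSpace.single 0 1, by simp⟩
  have hv : -v ≠ v := fun h => by
    have := congrArg (fun x : S3 => (x : E 4) 0) h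
    norm_num [v] at this
  refine ψ.exists_primitive_of_union (U := {v}ᶜ) (V := {-v}ᶜ) isOpen_compl_singleton
    isOpen_compl_singleton ?_ (isSimplyConnected_compl_singleton v)
    (isSimplyConnected_compl_singleton _) (isPathConnected_compl_pair hv)
  rw [← compl_inter, singleton_inter_eq_empty.2 (by simpa using hv.symm), compl_empty]

/-! ### Groupoid homomorphisms to the integers -/

section GroupoidHom

variable {X : Type} [TopologicalSpace X]

theorem GroupoidHom.eval_trans (φ : GroupoidHom X) {x y z : X} (γ : Path x y) (δ : Path y z) :
    φ.eval (γ.trans δ) = φ.eval γ + φ.eval δ := by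
  have h := φ.map_comp (FundamentalGroupoid.fromPath (Path.Homotopic.Quotient.mk γ))
    (FundamentalGroupoid.fromPath (Path.Homotopic.Quotient.mk δ))
  rw [CategoryTheory.SingleObj.comp_as_mul] at h
  exact (congrArg Multiplicative.toAdd h).trans (add_comm _ _)

theorem GroupoidHom.eval_eq_of_homotopic (φ : GroupoidHom X) {x y : X} {γ δ : Path x y}
    (h : γ.Homotopic δ) : φ.eval γ = φ.eval δ := by
  rw [GroupoidHom.eval, GroupoidHom.eval, Path.Homotopic.Quotient.eq.2 h]

theorem GroupoidHom.eval_toContinuousMap (φ : GroupoidHom X) {x y : X} (γ : Path x y) :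
    φ.eval (⟨γ.toContinuousMap, rfl, rfl⟩ : Path _ _) = φ.eval γ := by
  obtain ⟨γ, rfl, rfl⟩ := γ
  rfl

/-- A homomorphism to `ℤ`, as a function on unbundled paths. -/
def GroupoidHom.toPathHom (φ : GroupoidHom X) : PathHom X (Multiplicative ℤ) where
  toFun γ := Multiplicative.ofAdd (φ.eval (⟨γ, rfl, rfl⟩ : Path (γ 0) (γ 1)))
  map_homotopic γ δ h := by
    rw [φ.eval_toContinuousMap γ, φ.eval_toContinuousMap δ, φ.eval_eq_of_homotopic h]
  map_trans γ δ := by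
    rw [φ.eval_toContinuousMap γ, φ.eval_toContinuousMap δ, φ.eval_toContinuousMap, φ.eval_trans,
      ofAdd_add]

theorem GroupoidHom.toPathHom_apply (φ : GroupoidHom X) {x y : X} (γ : Path x y) :
    φ.toPathHom.toFun γ.toContinuousMap = Multiplicative.ofAdd (φ.eval γ) :=
  congrArg Multiplicative.ofAdd (φ.eval_toContinuousMap γ)

/-- A homomorphism to `ℤ`, as a functor. -/
def PathHom.toGroupoidHom (ψ : PathHom X (Multiplicative ℤ)) : GroupoidHom X where
  obj _ := CategoryTheory.SingleObj.star _
  map {x y} p := Quotient.lift (fun γ : Path x.as y.as => ψ.toFun γ.toContinuousMap)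
    (fun γ δ h => ψ.map_homotopic γ δ h) p
  map_id x := ψ.map_eq_one_of_const x.as
  map_comp {x y z} p q := by
    induction p using Quotient.ind with | _ γ => ?_
    induction q using Quotient.ind with | _ δ => ?_
    exact (ψ.map_trans γ δ).trans (mul_comm _ _)

theorem PathHom.eval_toGroupoidHom (ψ : PathHom X (Multiplicative ℤ)) {x y : X} (γ : Path x y) :
    ψ.toGroupoidHom.eval γ = Multiplicative.toAdd (ψ.toFun γ.toContinuousMap) := rfl

end GroupoidHom

/-! ### Twisted cocycles -/

section TwistedCocycle

variable {X : Type} [TopologicalSpace X] {K : Type} [Field K]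

/-- The singular 1-simplex given by a path. -/
def pathSimplex (γ : C(I, X)) : Simplex X 1 :=
  γ.comp ⟨stdSimplexHomeomorphUnitInterval, stdSimplexHomeomorphUnitInterval.continuous⟩

/-- The path given by a singular 1-simplex. -/
def simplexPath (τ : Simplex X 1) : C(I, X) :=
  τ.comp ⟨stdSimplexHomeomorphUnitInterval.symm, stdSimplexHomeomorphUnitInterval.symm.continuous⟩

@[simp]
theorem simplexPath_pathSimplex (γ : C(I, X)) : simplexPath (pathSimplex γ) = γ := by
  ext t; simp [simplexPath, pathSimplex]

theorem Simplex.sub_id {n : ℕ} (τ : Simplex X n) (f : Fin (n + 1) → Fin (n + 1))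
    (hf : ∀ i, f i = i) : τ.sub f = τ := by
  obtain rfl : f = id := funext hf
  ext x
  simp [Simplex.sub]

theorem Simplex.edge_toContinuousMap {n : ℕ} (τ : Simplex X (n + 1)) :
    τ.edge.toContinuousMap = simplexPath (τ.sub ![0, 1]) := rfl

/-- The edge of the standard 2-simplex from the vertex `a` to the vertex `b`. -/
def triangleEdge (a b : Fin 3) :
    Path (stdSimplex.vertex a : stdSimplex ℝ (Fin 3)) (stdSimplex.vertex b) where
  toFun s := stdSimplex.map ![a, b] (stdSimplexHomeomorphUnitInterval.symm s)
  continuous_toFun := (stdSimplex.continuous_map _).comp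
    stdSimplexHomeomorphUnitInterval.symm.continuous
  source' := by
    rw [← stdSimplexHomeomorphUnitInterval_zero, Homeomorph.symm_apply_apply]
    exact stdSimplex.map_vertex _ _
  target' := by
    rw [← stdSimplexHomeomorphUnitInterval_one, Homeomorph.symm_apply_apply]
    exact stdSimplex.map_vertex _ _

/-- A 1-cocycle with values in the local system in which the transport along `γ` is
multiplication by `t ^ φ(γ)`, as a function on paths. -/
structure IsTwistedCocycle (t : Kˣ) (φ : GroupoidHom X) (c : C(I, X) → K) : Prop where
  map_homotopic : ∀ {x y : X} (γ δ : Path x y), γ.Homotopic δ →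
    c γ.toContinuousMap = c δ.toContinuousMap
  map_trans : ∀ {x y z : X} (γ : Path x y) (δ : Path y z), c (γ.trans δ).toContinuousMap =
    c γ.toContinuousMap + ((t ^ φ.eval γ : Kˣ) : K) * c δ.toContinuousMap

/-- The linear functional on singular 1-chains given by a function on paths. -/
def chainFunctional (c : C(I, X) → K) : (Simplex X 1 →₀ K) →ₗ[K] K :=
  Finsupp.linearCombination K fun τ => c (simplexPath τ)

@[simp]
theorem chainFunctional_single (c : C(I, X) → K) (γ : C(I, X)) (a : K) :
    chainFunctional c (Finsupp.single (pathSimplex γ) a) = a * c γ := by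
  simp [chainFunctional]

theorem IsTwistedCocycle.comp_twistedBoundary {t : Kˣ} {φ : GroupoidHom X} {c : C(I, X) → K}
    (hc : IsTwistedCocycle t φ c) : chainFunctional c ∘ₗ twistedBoundary t φ 1 = 0 := by
  ext τ
  have : ContractibleSpace (stdSimplex ℝ (Fin 3)) :=
    (convex_stdSimplex ℝ (Fin 3)).contractibleSpace ⟨_, single_mem_stdSimplex ℝ 0⟩
  have h := hc.map_homotopic _ _ ((SimplyConnectedSpace.paths_homotopic
    ((triangleEdge 0 1).trans (triangleEdge 1 2)) (triangleEdge 0 2)).map τ)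
  rw [Path.map_trans, hc.map_trans] at h
  have key (a b : Fin 3) (f : Fin 2 → Fin 3) (hf : f = ![a, b]) :
      ((triangleEdge a b).map τ.continuous).toContinuousMap = simplexPath (τ.sub f) := by
    subst hf; rfl
  have he : φ.eval τ.edge = φ.eval ((triangleEdge 0 1).map τ.continuous) := by
    refine Multiplicative.ofAdd.injective ?_
    rw [← φ.toPathHom_apply, ← φ.toPathHom_apply]
    rfl
  rw [key 0 1 (Fin.succAbove 2) (by decide), key 1 2 (Fin.succAbove 0) (by decide),
    key 0 2 (Fin.succAbove 1) (by decide), ← he] at h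
  have hsum : twistedBoundary t φ 1 (Finsupp.single τ 1) =
      Finsupp.single (τ.sub (Fin.succAbove 0)) ((t ^ φ.eval τ.edge : Kˣ) : K) +
        (Finsupp.single (τ.sub (Fin.succAbove 1)) (-1) +
          Finsupp.single (τ.sub (Fin.succAbove 2)) 1) := by
    rw [twistedBoundary, Finsupp.linearCombination_single, one_smul]
    refine congrArg₂ _ rfl ((Fin.sum_univ_two _).trans (congrArg₂ _ ?_ ?_))
    · simp; rfl
    · simp; rfl
  simp only [LinearMap.coe_comp, Function.comp_apply, Finsupp.lsingle_apply, LinearMap.zero_apply]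
  rw [hsum]
  simp only [chainFunctional, map_add, Finsupp.linearCombination_single, smul_eq_mul]
  linear_combination h

theorem pathSimplex_edge_eval (φ : GroupoidHom X) {x y : X} (γ : Path x y) :
    φ.eval (pathSimplex γ.toContinuousMap).edge = φ.eval γ := by
  refine Multiplicative.ofAdd.injective ?_
  rw [← φ.toPathHom_apply, ← φ.toPathHom_apply, Simplex.edge_toContinuousMap,
    Simplex.sub_id _ _ (by decide), simplexPath_pathSimplex]

/-- The singular 0-simplex given by a point. -/
def pointSimplex (x : X) : Simplex X 0 := .const _ x

theorem pathSimplex_face_zero {x y : X} (γ : Path x y) :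
    (pathSimplex γ.toContinuousMap).face 0 = pointSimplex y := by
  ext p
  have hp : p = stdSimplex.vertex 0 := Subsingleton.elim _ _
  subst hp
  change γ (stdSimplexHomeomorphUnitInterval (stdSimplex.map _ _)) = y
  rw [stdSimplex.map_vertex]
  exact γ.target

theorem pathSimplex_face_one {x y : X} (γ : Path x y) :
    (pathSimplex γ.toContinuousMap).face 1 = pointSimplex x := by
  ext p
  have hp : p = stdSimplex.vertex 0 := Subsingleton.elim _ _
  subst hp
  change γ (stdSimplexHomeomorphUnitInterval (stdSimplex.map _ _)) = x
  rw [stdSimplex.map_vertex]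
  exact γ.source

theorem twistedBoundary_pathSimplex (t : Kˣ) (φ : GroupoidHom X) {x y : X} (γ : Path x y) (a : K) :
    twistedBoundary t φ 0 (Finsupp.single (pathSimplex γ.toContinuousMap) a) =
      Finsupp.single (pointSimplex y) (a * ((t ^ φ.eval γ : Kˣ) : K)) -
        Finsupp.single (pointSimplex x) a := by
  simp [twistedBoundary, pathSimplex_face_zero, pathSimplex_face_one, pathSimplex_edge_eval, sub_eq_add_neg]

/-- The rank is at least the size of a nondegenerate pairing of twisted cocycles with cycles. -/
theorem le_twistedRank_of_det_ne_zero {t : Kˣ} {φ : GroupoidHom X} {n : ℕ}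
    (c : Fin n → C(I, X) → K) (hc : ∀ j, IsTwistedCocycle t φ (c j))
    (z : Fin n → (Simplex X 1 →₀ K)) (hz : ∀ i, twistedBoundary t φ 0 (z i) = 0)
    (hdet : (Matrix.of fun i j => chainFunctional (c j) (z i)).det ≠ 0) :
    (n : Cardinal.{0}) ≤ twistedRank t φ := by
  let Λ : LinearMap.ker (twistedBoundary t φ 0) →ₗ[K] (Fin n → K) :=
    (LinearMap.pi fun j => chainFunctional (c j)) ∘ₗ Submodule.subtype _
  have hΛ : (LinearMap.range (twistedBoundary t φ 1)).submoduleOf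
      (LinearMap.ker (twistedBoundary t φ 0)) ≤ LinearMap.ker Λ := by
    rintro ⟨x, hx⟩ hx'
    obtain ⟨y, rfl⟩ := Submodule.mem_comap.1 hx'
    rw [LinearMap.mem_ker]
    ext j
    exact LinearMap.congr_fun (hc j).comp_twistedBoundary y
  have hind : LinearIndependent K fun i => Submodule.Quotient.mk
      (p := (LinearMap.range (twistedBoundary t φ 1)).submoduleOf
        (LinearMap.ker (twistedBoundary t φ 0)))
      (⟨z i, hz i⟩ : LinearMap.ker (twistedBoundary t φ 0)) := by
    refine LinearIndependent.of_comp (Submodule.liftQ _ Λ hΛ) ?_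
    exact Matrix.linearIndependent_rows_of_det_ne_zero hdet
  have h := hind.cardinal_le_rank
  rw [Cardinal.mk_fin] at h
  exact h

end TwistedCocycle

/-! ### Fox calculus -/

section Fox

open LaurentPolynomial

variable {ι : Type} [DecidableEq ι]

/-- The total exponent of an element of a free group. -/
def totalDegree (ι : Type) : FreeGroup ι →* Multiplicative ℤ :=
  FreeGroup.lift fun _ => Multiplicative.ofAdd 1

/-- The exponent of the generator `j` in an element of a free group. -/
def exponent (j : ι) : FreeGroup ι →* Multiplicative ℤ :=
  FreeGroup.lift fun i => if i = j then Multiplicative.ofAdd 1 else 1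

theorem exists_foxDerivative (j : ι) : ∃ d : FreeGroup ι → ℤ[T;T⁻¹],
    (∀ i, d (.of i) = if i = j then 1 else 0) ∧
    ∀ g h, d (g * h) = d g + T (totalDegree ι g).toAdd * d h := by
  -- let the generator `i` act by the affine map `x ↦ T * x + δ i j`
  let a (i : ι) : Equiv.Perm ℤ[T;T⁻¹] :=
    { toFun := fun x => T 1 * x + if i = j then 1 else 0
      invFun := fun y => T (-1) * (y - if i = j then 1 else 0)
      left_inv := fun x => by
        change T (-1) * (T 1 * x + _ - _) = x
        rw [add_sub_cancel_right, ← mul_assoc, ← T_add]; simp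
      right_inv := fun x => by
        change T 1 * (T (-1) * (x - _)) + _ = x
        rw [← mul_assoc, ← T_add]; simp }
  let ρ : FreeGroup ι →* Equiv.Perm ℤ[T;T⁻¹] := FreeGroup.lift a
  have hρ (g : FreeGroup ι) : ∀ x, ρ g x = T (totalDegree ι g).toAdd * x + ρ g 0 := by
    induction g using FreeGroup.induction_on with
    | C1 => intro x; simp
    | of i => intro x; simp [ρ, a, totalDegree]
    | inv_of i h =>
      intro x
      simp only [map_inv, toAdd_inv]
      rw [Equiv.Perm.inv_eq_iff_eq, h, mul_add, ← mul_assoc, ← T_add]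
      have h0 := h ((ρ (.of i))⁻¹ 0)
      rw [show ρ (.of i) ((ρ (.of i))⁻¹ 0) = 0 from Equiv.apply_symm_apply _ _] at h0
      simp only [add_neg_cancel, T_zero, one_mul]
      linear_combination h0
    | mul g h hg hh =>
      intro x
      simp only [map_mul, Equiv.Perm.mul_apply, toAdd_mul, T_add]
      rw [hh x, hg, hg (ρ h 0)]
      ring
  refine ⟨fun g => ρ g 0, fun i => by simp [ρ, a], fun g h => ?_⟩
  simp only [map_mul, Equiv.Perm.mul_apply]
  rw [hρ g (ρ h 0), add_comm]

/-- The Fox derivative with respect to the generator `j`, with all generators mapped to `T`. -/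
def foxDerivative (j : ι) : FreeGroup ι → ℤ[T;T⁻¹] := (exists_foxDerivative j).choose

theorem foxDerivative_of (j i : ι) : foxDerivative j (.of i) = if i = j then 1 else 0 :=
  (exists_foxDerivative j).choose_spec.1 i

theorem foxDerivative_mul (j : ι) (g h : FreeGroup ι) : foxDerivative j (g * h) =
    foxDerivative j g + T (totalDegree ι g).toAdd * foxDerivative j h :=
  (exists_foxDerivative j).choose_spec.2 g h

/-- The evaluation of Laurent polynomials at `T = 1`. -/
def evalOne : ℤ[T;T⁻¹] →+* ℤ := eval₂ (RingHom.id ℤ) 1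

@[simp]
theorem evalOne_T (n : ℤ) : evalOne (T n) = 1 := by simp [evalOne]

/-- At `T = 1` the Fox derivatives become the exponents of the generators. -/
theorem evalOne_foxDerivative (j : ι) (g : FreeGroup ι) :
    evalOne (foxDerivative j g) = (exponent j g).toAdd := by
  let f : FreeGroup ι →* Multiplicative ℤ := MonoidHom.mk'
    (fun g => Multiplicative.ofAdd (evalOne (foxDerivative j g))) fun g h => by
      simp [foxDerivative_mul, ofAdd_add]
  have : f = exponent j := by
    ext i
    simp only [f, exponent, MonoidHom.mk'_apply, foxDerivative_of, FreeGroup.lift_apply_of]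
    split_ifs <;> simp
  rw [← this]
  rfl

theorem eval₂_ne_zero_of_evalOne {K : Type} [Field K] (t : Kˣ) (ht : Transcendental ℤ (t : K))
    {p : ℤ[T;T⁻¹]} (hp : evalOne p ≠ 0) : eval₂ (Int.castRingHom K) t p ≠ 0 := by
  obtain ⟨n, q, hq⟩ := exists_T_pow p
  have hq0 : q ≠ 0 := by
    rintro rfl
    have := congrArg evalOne hq
    simp only [map_zero, map_mul, evalOne_T, mul_one] at this
    exact hp this.symm
  intro h0
  have h1 := congrArg (eval₂ (Int.castRingHom K) t) hq
  rw [map_mul, h0, zero_mul, eval₂_toLaurent] at h1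
  exact ht ⟨q, hq0, h1⟩

end Fox

/-! ### The rank of a space with a homomorphism to a free group -/

section RankBound

open LaurentPolynomial

variable {X : Type} [TopologicalSpace X] {K : Type} [Field K]

/-- If a homomorphism from the fundamental groupoid to a free group lifts `φ` up to a coboundary
`h`, then the Fox derivatives pull back to twisted cocycles. -/
theorem isTwistedCocycle_foxDerivative {ι : Type} [DecidableEq ι] (t : Kˣ) {φ : GroupoidHom X}
    (Ψ : PathHom X (FreeGroup ι)) (h : X → Multiplicative ℤ)
    (hφ : ∀ γ, φ.toPathHom.toFun γ = totalDegree ι (Ψ.toFun γ) * ((h (γ 0))⁻¹ * h (γ 1))) (j : ι) :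
    IsTwistedCocycle t φ fun γ => ((t ^ (-(h (γ 0)).toAdd) : Kˣ) : K) *
      eval₂ (Int.castRingHom K) t (foxDerivative j (Ψ.toFun γ)) where
  map_homotopic γ δ hγ := by simp [Ψ.map_homotopic γ δ hγ]
  map_trans {x y z} γ δ := by
    have h1 := congrArg Multiplicative.toAdd
      ((φ.toPathHom_apply γ).symm.trans (hφ γ.toContinuousMap))
    simp only [toAdd_ofAdd, toAdd_mul, toAdd_inv, Path.coe_toContinuousMap, Path.source,
      Path.target] at h1
    simp only [Path.coe_toContinuousMap, Path.source, Ψ.map_trans, foxDerivative_mul, map_add,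
      map_mul, eval₂_T, h1]
    have h2 : (t ^ (-(h x).toAdd) : Kˣ) * t ^ (totalDegree ι (Ψ.toFun γ.toContinuousMap)).toAdd =
        t ^ ((totalDegree ι (Ψ.toFun γ.toContinuousMap)).toAdd + (-(h x).toAdd + (h y).toAdd)) *
          t ^ (-(h y).toAdd) := by
      rw [← zpow_add, ← zpow_add]
      congr 1; ring
    have h3 := congrArg (Units.val) h2
    simp only [Units.val_mul] at h3
    rw [mul_add, ← mul_assoc, h3, mul_assoc]

/-- If `X` maps to a wedge of `n + 1` circles in such a way that there are loops whose images are
homologous to the circles, then the rank is at least `n`. -/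
theorem le_twistedRank_of_freeGroup [PathConnectedSpace X] (t : Kˣ)
    (ht : Transcendental ℤ (t : K)) {φ : GroupoidHom X} {n : ℕ}
    (Ψ : PathHom X (FreeGroup (Fin (n + 1)))) (h : X → Multiplicative ℤ)
    (hφ : ∀ γ, φ.toPathHom.toFun γ =
      totalDegree _ (Ψ.toFun γ) * ((h (γ 0))⁻¹ * h (γ 1)))
    (p : Fin (n + 1) → X) (μ : ∀ i, Path (p i) (p i)) (hμφ : ∀ i, φ.eval (μ i) = 1)
    (hμ : ∀ i j, exponent j (Ψ.toFun (μ i).toContinuousMap) =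
      if i = j then Multiplicative.ofAdd 1 else 1) :
    (n : Cardinal.{0}) ≤ twistedRank t φ := by
  let γ (i : Fin (n + 1)) : Path (p i) (p 0) := PathConnectedSpace.somePath _ _
  let c (j : Fin n) : C(I, X) → K := fun γ => ((t ^ (-(h (γ 0)).toAdd) : Kˣ) : K) *
      eval₂ (Int.castRingHom K) t (foxDerivative j.succ (Ψ.toFun γ))
  -- the difference of the loops `μ i` and `μ 0`, joined by the path `γ i`; the factor cancels the
  -- one in `c j`, so that the pairing is a Laurent polynomial in `t` that does not involve `h`
  let z (i : Fin n) : Simplex X 1 →₀ K := ((t ^ (h (p i.succ)).toAdd : Kˣ) : K) •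
    (Finsupp.single (pathSimplex (μ i.succ).toContinuousMap) 1 +
      Finsupp.single (pathSimplex (γ i.succ).toContinuousMap) ((t : K) - 1) -
      Finsupp.single (pathSimplex (μ 0).toContinuousMap) ((t ^ φ.eval (γ i.succ) : Kˣ) : K))
  let D : Matrix (Fin n) (Fin n) ℤ[T;T⁻¹] := Matrix.of fun i j =>
    foxDerivative j.succ (Ψ.toFun (μ i.succ).toContinuousMap) +
      (T 1 - 1) * foxDerivative j.succ (Ψ.toFun (γ i.succ).toContinuousMap) -
      T (totalDegree _ (Ψ.toFun (γ i.succ).toContinuousMap)).toAdd *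
        foxDerivative j.succ (Ψ.toFun (μ 0).toContinuousMap)
  have hD : evalOne D.det = 1 := by
    have h1 : evalOne.mapMatrix D = 1 := by
      ext i j
      simp [D, evalOne_foxDerivative, hμ, Matrix.one_apply, (Fin.succ_ne_zero _).symm, apply_ite]
    rw [RingHom.map_det, h1, Matrix.det_one]
  refine le_twistedRank_of_det_ne_zero c
    (fun j => isTwistedCocycle_foxDerivative t Ψ h hφ j.succ) z (fun i => ?_) ?_
  · simp only [z, map_smul, map_add, map_sub, twistedBoundary_pathSimplex, hμφ, zpow_one]
    rw [smul_eq_zero]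
    right
    classical
    ext q
    simp only [Finsupp.coe_add, Finsupp.coe_sub, Pi.add_apply, Pi.sub_apply, Finsupp.single_apply,
      Finsupp.coe_zero, Pi.zero_apply]
    split_ifs <;> ring
  · have hM : (Matrix.of fun i j => chainFunctional (c j) (z i)) =
        (eval₂ (Int.castRingHom K) t).mapMatrix D := by
      ext i j
      have h1 := congrArg Multiplicative.toAdd
        ((φ.toPathHom_apply (γ i.succ)).symm.trans (hφ (γ i.succ).toContinuousMap))
      simp only [toAdd_ofAdd, toAdd_mul, toAdd_inv, Path.coe_toContinuousMap, Path.source,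
        Path.target] at h1
      simp only [z, c, D, Matrix.of_apply, map_smul, map_add, map_sub, chainFunctional_single,
        Path.coe_toContinuousMap, Path.source, RingHom.mapMatrix_apply, Matrix.map_apply, map_mul,
        eval₂_T, map_one, h1, smul_eq_mul, zpow_add, Units.val_mul, zpow_neg, zpow_one, one_mul]
      have e1 : ((t ^ (h (p i.succ)).toAdd : Kˣ) : K) * (((t ^ (h (p i.succ)).toAdd)⁻¹ : Kˣ) : K)
        = 1 := by rw [← Units.val_mul, mul_inv_cancel, Units.val_one]
      have e2 : ((t ^ (h (p 0)).toAdd : Kˣ) : K) * (((t ^ (h (p 0)).toAdd)⁻¹ : Kˣ) : K)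
        = 1 := by rw [← Units.val_mul, mul_inv_cancel, Units.val_one]
      generalize ((t ^ (h (p i.succ)).toAdd : Kˣ) : K) = a at *
      generalize (((t ^ (h (p i.succ)).toAdd)⁻¹ : Kˣ) : K) = a' at *
      generalize ((t ^ (h (p 0)).toAdd : Kˣ) : K) = b at *
      generalize (((t ^ (h (p 0)).toAdd)⁻¹ : Kˣ) : K) = b' at *
      set u := eval₂ (Int.castRingHom K) t
        (foxDerivative j.succ (Ψ.toFun (μ i.succ).toContinuousMap))
      set v := eval₂ (Int.castRingHom K) t
        (foxDerivative j.succ (Ψ.toFun (γ i.succ).toContinuousMap))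
      set x := eval₂ (Int.castRingHom K) t
        (foxDerivative j.succ (Ψ.toFun (μ 0).toContinuousMap))
      set d := ((t ^ (totalDegree _ (Ψ.toFun (γ i.succ).toContinuousMap)).toAdd : Kˣ) : K)
      linear_combination (u + (t - 1) * v - d * b * b' * x) * e1 - d * x * e2
    rw [hM, ← RingHom.map_det]
    exact eval₂_ne_zero_of_evalOne t ht (by rw [hD]; exact one_ne_zero)

end RankBound

/-! ### Transition maps between charts -/

section Charts

/-- The derivative at `p` of the local parametrization given by a chart. -/
def chartDeriv (e : OpenPartialHomeomorph S3 (E 3)) (p : E 3) : E 3 →L[ℝ] E 4 :=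
  fderiv ℝ (fun q : E 3 => ((e.symm q : S3) : E 4)) p

variable {e e' : OpenPartialHomeomorph S3 (E 3)}

theorem sum_smul_single (u : E 3) : u = ∑ j, u j • EuclideanSpace.single j (1 : ℝ) := by
  ext i
  simp [Fin.sum_univ_three]
  fin_cases i <;> simp

theorem chartDeriv_apply (e : OpenPartialHomeomorph S3 (E 3)) (p u : E 3) :
    chartDeriv e p u = ∑ j, u j • coordVec e p j := by
  conv_lhs => rw [sum_smul_single u]
  simp [map_sum, chartDeriv, coordVec]

theorem IsPositiveChart.hasStrictFDerivAt (he : IsPositiveChart e) {p : E 3} (hp : p ∈ e.target) :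
    HasStrictFDerivAt (fun q : E 3 => ((e.symm q : S3) : E 4)) (chartDeriv e p) p :=
  (he.1.contDiffAt (e.open_target.mem_nhds hp)).hasStrictFDerivAt (by simp)

theorem IsPositiveChart.injective_chartDeriv (he : IsPositiveChart e) {p : E 3}
    (hp : p ∈ e.target) : Function.Injective (chartDeriv e p) := by
  rw [injective_iff_map_eq_zero]
  intro u hu
  rw [chartDeriv_apply] at hu
  have h : Matrix.vecMul (Fin.cons 0 u : Fin 4 → ℝ) (frameMatrix (e.symm p : S3) (coordVec e p))
      = 0 := by
    ext i
    have := congrArg (fun v : E 4 => v i) hu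
    rw [Matrix.vecMul, dotProduct, Fin.sum_univ_succ]
    simpa [frameMatrix] using this
  have h0 := Matrix.eq_zero_of_vecMul_eq_zero (he.2 p hp).ne' h
  ext i
  simpa using congrFun h0 i.succ

/-- Transition maps are differentiable, with the expected derivative. -/
theorem exists_hasFDerivAt_transition (he : IsPositiveChart e) (he' : IsPositiveChart e')
    {x : S3} (hx : x ∈ e.source) (hx' : x ∈ e'.source) :
    ∃ L : E 3 →L[ℝ] E 3, HasFDerivAt (fun p => e' (e.symm p)) L (e x) ∧
      ∀ u, chartDeriv e' (e' x) (L u) = chartDeriv e (e x) u := by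
  have hcont : ContinuousAt (fun p => e' (e.symm p)) (e x) := by
    refine ContinuousAt.comp (g := e') ?_ (e.continuousAt_symm (e.map_source hx))
    rw [e.left_inv hx]
    exact e'.continuousAt hx'
  have hev : ∀ᶠ p in 𝓝 (e x), e.symm p ∈ e'.source :=
    (e.continuousAt_symm (e.map_source hx)).eventually
      (e'.open_source.mem_nhds (by rwa [e.left_inv hx]))
  have hD := he.hasStrictFDerivAt (e.map_source hx)
  have hD' := he'.hasStrictFDerivAt (e'.map_source hx')
  -- compose the parametrization with a linear left inverse of its derivative, and invert locally
  obtain ⟨P, hP⟩ := LinearMap.exists_leftInverse_of_injective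
    (chartDeriv e' (e' x) : E 3 →ₗ[ℝ] E 4)
    (LinearMap.ker_eq_bot.2 (he'.injective_chartDeriv (e'.map_source hx')))
  let P' : E 4 →L[ℝ] E 3 := LinearMap.toContinuousLinearMap P
  have hf : HasStrictFDerivAt (fun q => P' ((e'.symm q : S3) : E 4))
      ((ContinuousLinearEquiv.refl ℝ (E 3) : E 3 ≃L[ℝ] E 3) : E 3 →L[ℝ] E 3) (e' x) := by
    have h := P'.hasStrictFDerivAt.comp (e' x) hD'
    have hid : P'.comp (chartDeriv e' (e' x)) = ContinuousLinearMap.id ℝ (E 3) :=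
      ContinuousLinearMap.ext fun u => LinearMap.congr_fun hP u
    rw [hid] at h
    exact h
  have hux : e' (e.symm (e x)) = e' x := by rw [e.left_inv hx]
  have hg := hf.to_localInverse.hasFDerivAt
  have hinv := hf.eventually_left_inverse
  set g := hf.localInverse _ _ _
  have heq : (fun p => e' (e.symm p)) =ᶠ[𝓝 (e x)] fun p => g (P' ((e.symm p : S3) : E 4)) := by
    have h1 := hcont.tendsto
    simp only [hux] at h1
    filter_upwards [h1.eventually hinv, hev] with p hp hp'
    rw [← hp, e'.left_inv hp']
  have hPx : P' ((e'.symm (e' x) : S3) : E 4) = P' ((e.symm (e x) : S3) : E 4) := by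
    rw [e'.left_inv hx', e.left_inv hx]
  rw [hPx] at hg
  have hu := (hg.comp (e x) (P'.hasFDerivAt.comp (e x) hD.hasFDerivAt)).congr_of_eventuallyEq heq
  refine ⟨_, hu, fun v => ?_⟩
  have hchain : HasFDerivAt (fun p => ((e'.symm (e' (e.symm p)) : S3) : E 4)) _ (e x) :=
    HasFDerivAt.comp (e x) (g := fun q => ((e'.symm q : S3) : E 4))
      (by rw [hux]; exact hD'.hasFDerivAt) hu
  have hchain' := hchain.congr_of_eventuallyEq (f₁ := fun p => ((e.symm p : S3) : E 4)) (by
    filter_upwards [hev] with p hp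
    rw [e'.left_inv hp])
  exact DFunLike.congr_fun (hchain'.unique hD.hasFDerivAt) v

/-- Transition maps between positive charts preserve the orientation. -/
theorem det_transition_pos (he : IsPositiveChart e) (he' : IsPositiveChart e')
    {x : S3} (hx : x ∈ e.source) (hx' : x ∈ e'.source) {L : E 3 →L[ℝ] E 3}
    (hL : ∀ u, chartDeriv e' (e' x) (L u) = chartDeriv e (e x) u) :
    0 < (Matrix.of fun i j => L (EuclideanSpace.single j 1) i).det := by
  set ℓ : Matrix (Fin 3) (Fin 3) ℝ := Matrix.of fun i j => L (EuclideanSpace.single j 1) i with hℓ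
  let M : Matrix (Fin 4) (Fin 4) ℝ :=
    Matrix.of (Fin.cons (Fin.cons 1 0) fun j => Fin.cons 0 fun i => ℓ i j)
  have hM : frameMatrix (e.symm (e x) : S3) (coordVec e (e x)) =
      M * frameMatrix (e'.symm (e' x) : S3) (coordVec e' (e' x)) := by
    rw [e.left_inv hx, e'.left_inv hx']
    ext i j
    rw [Matrix.mul_apply, Fin.sum_univ_succ]
    refine Fin.cases ?_ (fun i => ?_) i
    · simp [M, frameMatrix]
    · have h1 := hL (EuclideanSpace.single i 1)
      rw [chartDeriv_apply] at h1
      have h2 : coordVec e (e x) i = chartDeriv e (e x) (EuclideanSpace.single i 1) := rfl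
      simp [M, frameMatrix, h2, ← h1, hℓ]
  have hdet : M.det = ℓ.det := by
    rw [Matrix.det_succ_row_zero, Fin.sum_univ_succ]
    have hsub : M.submatrix Fin.succ (Fin.succAbove 0) = ℓ.transpose := by
      ext i j; simp [M]
    rw [hsub]
    simp [M]
  have h1 := he.2 _ (e.map_source hx)
  rw [hM, Matrix.det_mul, hdet] at h1
  exact pos_of_mul_pos_left h1 (he'.2 _ (e'.map_source hx')).le

/-- If a transition map preserves the direction of the `0`-axis, then it preserves the orientation
of the plane of the other two coordinates. -/
theorem transverse_det_pos (he : IsPositiveChart e) (he' : IsPositiveChart e')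
    {x : S3} (hx : x ∈ e.source) (hx' : x ∈ e'.source) {L : E 3 →L[ℝ] E 3}
    (hL : ∀ u, chartDeriv e' (e' x) (L u) = chartDeriv e (e x) u) {c : ℝ} (hc : 0 < c)
    (h0 : coordVec e (e x) 0 = c • coordVec e' (e' x) 0) :
    0 < L (EuclideanSpace.single 1 1) 1 * L (EuclideanSpace.single 2 1) 2 -
      L (EuclideanSpace.single 1 1) 2 * L (EuclideanSpace.single 2 1) 1 := by
  have hL0 : L (EuclideanSpace.single 0 1) = c • EuclideanSpace.single 0 1 := by
    refine he'.injective_chartDeriv (e'.map_source hx') ?_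
    rw [hL, map_smul]
    exact h0
  have h1 := det_transition_pos he he' hx hx' hL
  rw [Matrix.det_fin_three] at h1
  simp only [Matrix.of_apply, hL0] at h1
  simp at h1
  refine pos_of_mul_pos_right (a := c) ?_ hc.le
  linarith

end Charts

/-! ### The two sides of a surface -/

section Sides

variable {F : OrientedSurface} {e e' : OpenPartialHomeomorph S3 (E 3)}

/-- At an interior point of a surface, the points on the positive side with respect to one chart are
on the positive side with respect to any other one. -/
theorem OrientedSurface.eventually_pos_of_pos (he : F.IsChart e) (he' : F.IsChart e')
    {y : S3} (hyF : y ∈ F.carrier) (hy : y ∈ e.source) (hy' : y ∈ e'.source) (h1 : 0 < e y 1)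
    (h1' : 0 < e' y 1) : ∀ᶠ z in 𝓝 y, 0 < e z 2 → 0 < e' z 2 := by
  obtain ⟨L, hL, hLD⟩ := exists_hasFDerivAt_transition he.1 he'.1 hy hy'
  obtain ⟨-, n0, n1, n2⟩ := he.2.2 ⟨y, hyF⟩ hy
  obtain ⟨-, m0, m1, m2⟩ := he'.2.2 ⟨y, hyF⟩ hy'
  have hκ : 0 < L (EuclideanSpace.single 2 1) 2 := by
    have h := congrArg (inner ℝ (F.normal ⟨y, hyF⟩)) (hLD (EuclideanSpace.single 2 1))
    simp only [chartDeriv_apply, Fin.sum_univ_three, inner_add_right, inner_smul_right] at h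
    simp only [n0, n1, m0, m1, mul_zero, zero_add] at h
    simp at h
    refine pos_of_mul_pos_left ?_ m2.le
    rw [h]; exact n2
  have hy2 : e y 2 = 0 := ((he.2.1 y hy).1 hyF).1
  have hy2' : e' y 2 = 0 := ((he'.2.1 y hy').1 hyF).1
  have hsymm := e.continuousAt_symm (e.map_source hy)
  have hcoord (i : Fin 3) : Continuous fun p : E 3 => p i := by fun_prop
  -- a ball on which both charts are defined and which does not meet the boundary
  have hgood : ∀ᶠ p in 𝓝 (e y), p ∈ e.target ∧ e.symm p ∈ e'.source ∧ 0 < p 1 ∧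
      0 < e' (e.symm p) 1 := by
    have hc : ContinuousAt (fun p => e' (e.symm p) 1) (e y) := by
      refine (hcoord 1).continuousAt.comp (ContinuousAt.comp (g := e') ?_ hsymm)
      rw [e.left_inv hy]
      exact e'.continuousAt hy'
    refine (e.open_target.eventually_mem (e.map_source hy)).and ((hsymm.eventually
      (e'.open_source.mem_nhds (by rwa [e.left_inv hy]))).and
      (((hcoord 1).continuousAt.eventually (lt_mem_nhds h1)).and (hc.eventually
        (lt_mem_nhds (by simpa [e.left_inv hy] using h1')))))
  obtain ⟨ε, hε, hball⟩ := Metric.eventually_nhds_iff_ball.1 hgood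
  let B : Set (E 3) := Metric.ball (e y) ε ∩ {p | 0 < p 2}
  have hBconn : IsPreconnected B := by
    refine ((convex_ball _ _).inter ?_).isPreconnected
    exact convex_halfSpace_gt (f := fun p : E 3 => p 2) ⟨fun _ _ => rfl, fun _ _ => rfl⟩ 0
  have hBcont : ContinuousOn (fun p => e' (e.symm p) 2) B := fun p hp => by
    obtain ⟨hp1, hp2, -⟩ := hball p hp.1
    exact ((hcoord 2).continuousAt.comp (ContinuousAt.comp (g := e') (e'.continuousAt hp2)
      (e.continuousAt_symm hp1))).continuousWithinAt
  have hBne : ∀ p ∈ B, e' (e.symm p) 2 ≠ 0 := fun p hp h0 => by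
    obtain ⟨hp1, hp2, -, hp4⟩ := hball p hp.1
    have hF := (he'.2.1 _ hp2).2 ⟨h0, hp4.le⟩
    have := ((he.2.1 _ (e.map_target hp1)).1 hF).1
    rw [e.right_inv hp1] at this
    exact (ne_of_gt hp.2) this
  -- a point of `B` on the positive side, found by moving in the direction of the last coordinate
  have hex : ∃ p ∈ B, 0 < e' (e.symm p) 2 := by
    have hline : HasDerivAt (fun s : ℝ => e y + s • EuclideanSpace.single 2 (1 : ℝ))
        (EuclideanSpace.single 2 (1 : ℝ)) 0 := by
      simpa using ((hasDerivAt_id (0 : ℝ)).smul_const (EuclideanSpace.single 2 (1 : ℝ))).const_add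
        (e y)
    have hL' : HasFDerivAt (fun p => e' (e.symm p)) L
        (e y + (0 : ℝ) • EuclideanSpace.single 2 (1 : ℝ)) := by simpa using hL
    have hd := hL'.comp_hasDerivAt (0 : ℝ) hline
    have hd2 := (EuclideanSpace.proj 2 : E 3 →L[ℝ] ℝ).hasFDerivAt.comp_hasDerivAt (0 : ℝ) hd
    have hslope := (hasDerivAt_iff_tendsto_slope.1 hd2).eventually (lt_mem_nhds hκ)
    have hslope' := hslope.filter_mono (nhdsWithin_mono 0 (s := Ioi 0) fun s hs => ne_of_gt hs)
    have hnear : ∀ᶠ s in 𝓝[>] (0 : ℝ), e y + s • EuclideanSpace.single 2 (1 : ℝ) ∈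
        Metric.ball (e y) ε :=
      (hline.continuousAt.eventually (Metric.isOpen_ball.mem_nhds (by simpa using hε))).filter_mono
        nhdsWithin_le_nhds
    obtain ⟨s, ⟨hs1, hs2⟩, hs3⟩ := ((hslope'.and hnear).and self_mem_nhdsWithin).exists
    have hs3 : 0 < s := hs3
    refine ⟨_, ⟨hs2, ?_⟩, ?_⟩
    · simp [hy2, hs3]
    · simp only [slope, Function.comp_apply, zero_smul, add_zero, e.left_inv hy, vsub_eq_sub,
        smul_eq_mul, sub_zero] at hs1
      have h3 := pos_of_mul_pos_right hs1 (inv_pos.2 hs3).le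
      simpa [hy2'] using h3
  obtain ⟨p₀, hp₀, hp₀'⟩ := hex
  filter_upwards [(e.continuousAt hy).eventually (Metric.ball_mem_nhds _ hε),
    e.open_source.mem_nhds hy] with z hz hze hz2
  by_contra hneg
  have hzB : e z ∈ B := ⟨hz, hz2⟩
  have hneg' : e' (e.symm (e z)) 2 ≤ 0 := by rw [e.left_inv hze]; exact not_lt.1 hneg
  obtain ⟨p, hp, hp0⟩ := hBconn.intermediate_value hzB hp₀ hBcont ⟨hneg', hp₀'.le⟩
  exact hBne p hp hp0

/-- The closed positive side of a surface near an interior point does not depend on the chart. -/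
theorem OrientedSurface.eventually_nonneg_iff (he : F.IsChart e) (he' : F.IsChart e')
    {y : S3} (hyF : y ∈ F.carrier) (hy : y ∈ e.source) (hy' : y ∈ e'.source) (h1 : 0 < e y 1)
    (h1' : 0 < e' y 1) : ∀ᶠ z in 𝓝 y, (0 ≤ e z 2 ↔ 0 ≤ e' z 2) := by
  have hcoord : Continuous fun p : E 3 => p 1 := by fun_prop
  filter_upwards [eventually_pos_of_pos he he' hyF hy hy' h1 h1',
    eventually_pos_of_pos he' he hyF hy' hy h1' h1, e.open_source.mem_nhds hy,
    e'.open_source.mem_nhds hy',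
    (hcoord.continuousAt.comp (e.continuousAt hy)).eventually (lt_mem_nhds h1),
    (hcoord.continuousAt.comp (e'.continuousAt hy')).eventually (lt_mem_nhds h1')]
    with z ha hb hz hz' hz1 hz1'
  have hF := (he.2.1 z hz).symm.trans (he'.2.1 z hz')
  have h0 : e z 2 = 0 ↔ e' z 2 = 0 :=
    ⟨fun h => (hF.1 ⟨h, hz1.le⟩).1, fun h => (hF.2 ⟨h, hz1'.le⟩).1⟩
  rw [le_iff_lt_or_eq, le_iff_lt_or_eq, eq_comm, h0, eq_comm (a := (0 : ℝ)) (b := e' z 2)]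
  exact or_congr ⟨ha, hb⟩ Iff.rfl

end Sides

/-! ### The crossing homomorphism of a family of disjoint surfaces -/

section Crossing

variable {k m : ℕ} {J : OrientedLink k} {G : Type*} [Group G]

/-- The complement of a link. -/
abbrev OrientedLink.Complement {k : ℕ} (J : OrientedLink k) : Type := {z : S3 // z ∉ J.carrier}

theorem OrientedLink.isCompact_carrier (J : OrientedLink k) : IsCompact J.carrier :=
  isCompact_iUnion fun i => J.isCompact_component i

theorem OrientedLink.isOpen_compl_carrier (J : OrientedLink k) : IsOpen J.carrierᶜ :=
  J.isCompact_carrier.isClosed.isOpen_compl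

theorem OrientedSurface.boundary_subset (F : OrientedSurface) : F.boundary ⊆ F.carrier := by
  rintro x ⟨e, he, hx, h1, h2⟩
  exact (he.2.1 x hx).2 ⟨h2, h1.ge⟩

theorem OrientedSurface.pos_of_notMem_boundary {F : OrientedSurface}
    {e : OpenPartialHomeomorph S3 (E 3)} (he : F.IsChart e) {x : S3} (hx : x ∈ e.source)
    (hxF : x ∈ F.carrier) (hxb : x ∉ F.boundary) : 0 < e x 1 := by
  obtain ⟨h2, h1⟩ := (he.2.1 x hx).1 hxF
  exact h1.lt_of_ne' fun h => hxb ⟨e, he, hx, h, h2⟩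

open Classical in
/-- The local cocycle of the covering that is obtained by cutting along the surfaces `F i` and
regluing with the elements `g i`. Crossing `F i` in the positive direction contributes `g i`; the
surface itself belongs to its positive side. The chart used at `x` is chosen arbitrarily. -/
def sideCocycle (F : Fin m → OrientedSurface) (g : Fin m → G) (x z : S3) : G :=
  if h : ∃ i e, (F i).IsChart e ∧ x ∈ (F i).carrier ∧ x ∈ e.source then
    if 0 ≤ h.choose_spec.choose z 2 then 1 else (g h.choose)⁻¹
  else 1

variable {F : Fin m → OrientedSurface} {g : Fin m → G}

theorem sideCocycle_of_notMem {x : S3} (hx : ∀ i, x ∉ (F i).carrier) (z : S3) :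
    sideCocycle F g x z = 1 :=
  dif_neg fun ⟨i, _, _, h, _⟩ => hx i h

theorem eventually_sideCocycle_eq (hF : Pairwise fun i j => Disjoint (F i).carrier (F j).carrier)
    {i : Fin m} {x : S3} (hx : x ∈ (F i).carrier) (hxb : x ∉ (F i).boundary)
    {e : OpenPartialHomeomorph S3 (E 3)} (he : (F i).IsChart e) (hxe : x ∈ e.source) :
    ∀ᶠ z in 𝓝 x, sideCocycle F g x z = if 0 ≤ e z 2 then 1 else (g i)⁻¹ := by
  have h : ∃ i e, (F i).IsChart e ∧ x ∈ (F i).carrier ∧ x ∈ e.source := ⟨i, e, he, hx, hxe⟩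
  obtain ⟨he', hx', hxe'⟩ := h.choose_spec.choose_spec
  have hi : h.choose = i := by
    by_contra hne
    exact Set.disjoint_left.1 (hF hne) hx' hx
  have heq (z : S3) : sideCocycle F g x z =
      if 0 ≤ h.choose_spec.choose z 2 then 1 else (g h.choose)⁻¹ := dif_pos h
  simp only [heq]
  generalize h.choose_spec.choose = e' at *
  rw [hi] at he' ⊢
  filter_upwards [OrientedSurface.eventually_nonneg_iff he' he hx hxe' hxe
    (OrientedSurface.pos_of_notMem_boundary he' hxe' hx hxb)
    (OrientedSurface.pos_of_notMem_boundary he hxe hx hxb)] with z hz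
  simp only [hz]

theorem continuousAt_chart_apply {e : OpenPartialHomeomorph S3 (E 3)} {x : S3} (hx : x ∈ e.source)
    (i : Fin 3) : ContinuousAt (fun z => e z i) x :=
  (show Continuous fun p : E 3 => p i by fun_prop).continuousAt.comp (e.continuousAt hx)

theorem eventually_notMem_of_mem (hF : Pairwise fun i j => Disjoint (F i).carrier (F j).carrier)
    {i : Fin m} {x : S3} (hx : x ∈ (F i).carrier) :
    ∀ᶠ z in 𝓝 x, ∀ j, j ≠ i → z ∉ (F j).carrier := by
  refine eventually_all.2 fun j => ?_
  by_cases hj : j = i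
  · exact Eventually.of_forall fun z h => absurd hj h
  · filter_upwards [(F j).isCompact_carrier.isClosed.isOpen_compl.mem_nhds
      (fun h => Set.disjoint_left.1 (hF hj) h hx)] with z hz _
    exact hz

theorem isLocalCocycle_sideCocycle
    (hF : Pairwise fun i j => Disjoint (F i).carrier (F j).carrier)
    (hFJ : ∀ i, (F i).boundary ⊆ J.carrier) :
    IsLocalCocycle fun x z : J.Complement => sideCocycle F g x z := by
  suffices h : ∀ x : S3, x ∉ J.carrier → ∀ᶠ y in 𝓝 x, y ∉ J.carrier → ∀ᶠ z in 𝓝 y,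
      sideCocycle F g x z = sideCocycle F g x y * sideCocycle F g y z from fun x =>
    (continuous_subtype_val.tendsto x).eventually (h x x.2) |>.mono fun y hy =>
      (continuous_subtype_val.tendsto y).eventually (hy y.2)
  intro x hx
  by_cases hxF : ∃ i, x ∈ (F i).carrier
  · obtain ⟨i, hi⟩ := hxF
    obtain ⟨e, he, hxe⟩ := (F i).exists_chart x hi
    have hxb : x ∉ (F i).boundary := fun h => hx (hFJ i h)
    have h1 := OrientedSurface.pos_of_notMem_boundary he hxe hi hxb
    have hw := eventually_sideCocycle_eq (g := g) hF hi hxb he hxe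
    filter_upwards [hw, eventually_eventually_nhds.2 hw, e.open_source.mem_nhds hxe,
      (continuousAt_chart_apply hxe 1).eventually (lt_mem_nhds h1),
      eventually_notMem_of_mem hF hi] with y hy hy' hye hy1 hyj hyJ
    by_cases hyi : y ∈ (F i).carrier
    · have hy2 := ((he.2.1 y hye).1 hyi).1
      rw [hy, if_pos hy2.ge]
      filter_upwards [hy', eventually_sideCocycle_eq (g := g) hF hyi (fun h => hyJ (hFJ i h)) he
        hye] with z hz hz'
      rw [hz, hz', one_mul]
    · have hy2 : e y 2 ≠ 0 := fun h => hyi ((he.2.1 y hye).2 ⟨h, hy1.le⟩)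
      have hconst : ∀ᶠ z in 𝓝 y, (0 ≤ e z 2 ↔ 0 ≤ e y 2) := by
        rcases lt_or_gt_of_ne hy2 with h | h
        · filter_upwards [(continuousAt_chart_apply hye 2).eventually (gt_mem_nhds h)] with z hz
          exact iff_of_false hz.not_ge h.not_ge
        · filter_upwards [(continuousAt_chart_apply hye 2).eventually (lt_mem_nhds h)] with z hz
          exact iff_of_true hz.le h.le
      have hyF : ∀ j, y ∉ (F j).carrier := fun j => by
        by_cases hj : j = i
        · exact hj ▸ hyi
        · exact hyj j hj
      filter_upwards [hy', hconst] with z hz hz'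
      rw [hz, hy, sideCocycle_of_notMem hyF, mul_one]
      simp only [hz']
  · have hxF' : ∀ i, x ∉ (F i).carrier := fun i h => hxF ⟨i, h⟩
    have hop : ∀ᶠ y in 𝓝 x, ∀ i, y ∉ (F i).carrier := eventually_all.2 fun i =>
      (F i).isCompact_carrier.isClosed.isOpen_compl.eventually_mem (hxF' i)
    filter_upwards [hop] with y hy _
    refine Eventually.of_forall fun z => ?_
    rw [sideCocycle_of_notMem hxF', sideCocycle_of_notMem hxF', sideCocycle_of_notMem hy, one_mul]

/-- `Φ` is the homomorphism from the fundamental groupoid of the complement of a link to `G` that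
counts the crossings with the surfaces `F i`, with weights `g i`. -/
def IsCrossingHom (F : Fin m → OrientedSurface) (g : Fin m → G) (Φ : PathHom J.Complement G) :
    Prop :=
  ∀ (γ : C(I, J.Complement)) (s : I → G),
    IsLocalSection (fun a b => sideCocycle F g (γ a) (γ b)) s → Φ.toFun γ = (s 0)⁻¹ * s 1

theorem exists_isCrossingHom (hF : Pairwise fun i j => Disjoint (F i).carrier (F j).carrier)
    (hFJ : ∀ i, (F i).boundary ⊆ J.carrier) (g : Fin m → G) :
    ∃ Φ : PathHom J.Complement G, IsCrossingHom F g Φ :=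
  PathHom.exists_of_isLocalCocycle (isLocalCocycle_sideCocycle hF hFJ)

/-- Near the boundary of `F i`, the crossings are counted by the winding number around the
boundary: a path with polar coordinates `ρ, θ` in the plane transverse to the boundary crosses
`F i` whenever `θ` passes an integral multiple of `2π`. -/
theorem IsCrossingHom.eq_zpow_of_polar {Φ : PathHom J.Complement G} (hΦ : IsCrossingHom F g Φ)
    (hF : Pairwise fun i j => Disjoint (F i).carrier (F j).carrier)
    (hFJ : ∀ i, (F i).boundary ⊆ J.carrier) {i : Fin m}
    {e : OpenPartialHomeomorph S3 (E 3)} (he : (F i).IsChart e) (γ : C(I, J.Complement))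
    (hγe : ∀ t, (γ t : S3) ∈ e.source) (hγF : ∀ t j, j ≠ i → (γ t : S3) ∉ (F j).carrier)
    (ρ θ : I → ℝ) (hρ : ∀ t, 0 < ρ t) (hθ : Continuous θ)
    (h1 : ∀ t, e (γ t) 1 = ρ t * Real.cos (2 * Real.pi * θ t))
    (h2 : ∀ t, e (γ t) 2 = ρ t * Real.sin (2 * Real.pi * θ t)) :
    Φ.toFun γ = g i ^ (⌊θ 1⌋ - ⌊θ 0⌋) := by
  have hpi := Real.pi_pos
  have hγ : Continuous fun t => (γ t : S3) := continuous_subtype_val.comp γ.continuous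
  rw [hΦ γ (fun t => g i ^ ⌊θ t⌋) fun t => ?_]
  · rw [← zpow_neg, ← zpow_add]; congr 1; ring
  by_cases hn : ∃ n : ℤ, θ t = n
  · obtain ⟨n, hn⟩ := hn
    have hc : Real.cos (2 * Real.pi * θ t) = 1 := by
      rw [hn, mul_comm]; exact Real.cos_int_mul_two_pi n
    have hs : Real.sin (2 * Real.pi * θ t) = 0 := by
      rw [hn, show 2 * Real.pi * (n : ℝ) = ((2 * n : ℤ) : ℝ) * Real.pi by push_cast; ring]
      exact Real.sin_int_mul_pi _
    have hmem : (γ t : S3) ∈ (F i).carrier := by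
      refine (he.2.1 _ (hγe t)).2 ⟨by rw [h2, hs, mul_zero], ?_⟩
      rw [h1, hc, mul_one]; exact (hρ t).le
    have hw := (hγ.tendsto t).eventually (eventually_sideCocycle_eq (g := g) hF hmem
      (fun h => (γ t).2 (hFJ i h)) he (hγe t))
    have hlt : ∀ᶠ u in 𝓝 t, θ u < n + 1 / 2 :=
      hθ.continuousAt.eventually (gt_mem_nhds (by rw [hn]; linarith))
    have hgt : ∀ᶠ u in 𝓝 t, (n : ℝ) - 1 / 2 < θ u :=
      hθ.continuousAt.eventually (lt_mem_nhds (by rw [hn]; linarith))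
    filter_upwards [hw, hlt, hgt] with u hu hlt hgt
    have hsin : Real.sin (2 * Real.pi * θ u) = Real.sin (2 * Real.pi * (θ u - n)) := by
      rw [← Real.sin_sub_int_mul_two_pi _ n]
      congr 1; ring
    rw [hu, h2, hsin, hn, Int.floor_intCast]
    by_cases hle : (n : ℝ) ≤ θ u
    · have hfl : ⌊θ u⌋ = n := Int.floor_eq_iff.2 ⟨hle, by linarith⟩
      have hpos : 0 ≤ Real.sin (2 * Real.pi * (θ u - n)) :=
        Real.sin_nonneg_of_nonneg_of_le_pi (by nlinarith) (by nlinarith)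
      rw [if_pos (mul_nonneg (hρ u).le hpos), hfl, mul_one]
    · push Not at hle
      have hfl : ⌊θ u⌋ = n - 1 := Int.floor_eq_iff.2 ⟨by push_cast; linarith, by push_cast; linarith⟩
      have hneg : Real.sin (2 * Real.pi * (θ u - n)) < 0 :=
        Real.sin_neg_of_neg_of_neg_pi_lt (by nlinarith) (by nlinarith)
      rw [if_neg (mul_neg_of_pos_of_neg (hρ u) hneg).not_ge, hfl, zpow_sub_one]
  · push Not at hn
    have hnot : (γ t : S3) ∉ (F i).carrier := fun hmem => by
      obtain ⟨e2, e1⟩ := (he.2.1 _ (hγe t)).1 hmem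
      rw [h2, mul_eq_zero, or_iff_right (hρ t).ne'] at e2
      have hc : 0 ≤ Real.cos (2 * Real.pi * θ t) := by
        rw [h1] at e1; exact nonneg_of_mul_nonneg_right e1 (hρ t)
      have hc1 : Real.cos (2 * Real.pi * θ t) = 1 := by
        nlinarith [Real.sin_sq_add_cos_sq (2 * Real.pi * θ t)]
      obtain ⟨n, hn'⟩ := (Real.cos_eq_one_iff _).1 hc1
      refine hn n ?_
      have : 2 * Real.pi * (θ t - n) = 0 := by linear_combination -hn'
      have h0 := (mul_eq_zero.1 this).resolve_left (by positivity)
      linarith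
    have hnotF : ∀ j, (γ t : S3) ∉ (F j).carrier := fun j => by
      by_cases hj : j = i
      · exact hj ▸ hnot
      · exact hγF t j hj
    have hlt : ∀ᶠ u in 𝓝 t, θ u < ⌊θ t⌋ + 1 :=
      hθ.continuousAt.eventually (gt_mem_nhds (Int.lt_floor_add_one _))
    have hgt : ∀ᶠ u in 𝓝 t, (⌊θ t⌋ : ℝ) < θ u :=
      hθ.continuousAt.eventually (lt_mem_nhds ((Int.floor_le _).lt_of_ne (hn _).symm))
    filter_upwards [hlt, hgt] with u hlt hgt
    rw [sideCocycle_of_notMem hnotF, mul_one, Int.floor_eq_iff.2 ⟨hgt.le, hlt⟩]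

end Crossing

/-! ### Winding numbers of small meridians -/

section Winding

/-- A parametrized ellipse around the origin, with the conjugate radii `1` and `τ`, is never, at
any parameter `s`, in the direction opposite to the point of the unit circle with this parameter. -/
theorem ellipse_div_circle_mem_slitPlane {τ : ℂ} (hτ : 0 < τ.im) (s : ℝ) :
    (Real.cos s + τ * Real.sin s) * Complex.exp (-(s * Complex.I)) ∈ Complex.slitPlane := by
  set q := (Real.cos s + τ * Real.sin s) * Complex.exp (-(s * Complex.I)) with hq
  by_contra hn
  rw [Complex.mem_slitPlane_iff, not_or, not_lt, not_not] at hn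
  obtain ⟨hre, him⟩ := hn
  have h : (Real.cos s + τ * Real.sin s : ℂ) = q * (Real.cos s + Real.sin s * Complex.I) := by
    rw [Complex.ofReal_cos, Complex.ofReal_sin, ← Complex.exp_mul_I, hq, mul_assoc,
      ← Complex.exp_add]
    simp
  have h1 := congrArg Complex.re h
  have h2 := congrArg Complex.im h
  simp only [Complex.add_re, Complex.add_im, Complex.mul_re, Complex.mul_im, Complex.ofReal_re,
    Complex.ofReal_im, Complex.I_re, Complex.I_im, him] at h1 h2
  have hs : Real.sin s = 0 := by
    have : (τ.im - q.re) * Real.sin s = 0 := by linarith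
    exact (mul_eq_zero.1 this).resolve_left (by linarith)
  have hc : Real.cos s = 0 := by
    have : (1 - q.re) * Real.cos s = 0 := by rw [hs] at h1; linarith
    exact (mul_eq_zero.1 this).resolve_left (by linarith)
  have := Real.sin_sq_add_cos_sq s
  rw [hs, hc] at this
  norm_num at this

/-- A loop in the plane that is close to an ellipse around the origin, run through once in the
positive direction, has winding number one. -/
theorem exists_polar_of_near_ellipse {α β : ℂ} (h : 0 < α.re * β.im - α.im * β.re) :
    ∃ ε > 0, ∀ (ζ : I → ℂ) (r : ℝ), Continuous ζ → 0 < r → ζ 0 = ζ 1 →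
      (∀ t : I, ‖ζ t - r * (Real.cos (2 * Real.pi * t) * α + Real.sin (2 * Real.pi * t) * β)‖
        ≤ ε * r) →
      ∃ ρ θ : I → ℝ, (∀ t, 0 < ρ t) ∧ Continuous θ ∧ θ 1 = θ 0 + 1 ∧
        (∀ t, (ζ t).re = ρ t * Real.cos (2 * Real.pi * θ t)) ∧
        ∀ t, (ζ t).im = ρ t * Real.sin (2 * Real.pi * θ t) := by
  have hpi := Real.pi_pos
  have hα : α ≠ 0 := by
    rintro rfl
    simp at h
  have hτ : 0 < (β / α).im := by
    rw [Complex.div_im, ← sub_div]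
    exact div_pos (by linarith) (Complex.normSq_pos.2 hα)
  let f : I → ℂ := fun t => (Real.cos (2 * Real.pi * t) + β / α * Real.sin (2 * Real.pi * t)) *
    Complex.exp (-((2 * Real.pi * t : ℝ) * Complex.I))
  have hf : Continuous f := by fun_prop
  obtain ⟨δ, hδ, hth⟩ := (isCompact_range hf).exists_thickening_subset_open
    Complex.isOpen_slitPlane (by
      rintro _ ⟨t, rfl⟩
      exact ellipse_div_circle_mem_slitPlane hτ _)
  have hα' : 0 < ‖α‖ := norm_pos_iff.2 hα
  refine ⟨δ / 2 * ‖α‖, by positivity, fun ζ r hζ hr h01 hclose => ?_⟩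
  -- the quotient of the loop by a circle stays in the slit plane
  let q : I → ℂ := fun t => ζ t / (r * α) * Complex.exp (-((2 * Real.pi * t : ℝ) * Complex.I))
  have hr0 : (r : ℂ) ≠ 0 := by exact_mod_cast hr.ne'
  have hq : ∀ t, q t ∈ Complex.slitPlane := fun t => hth <| by
    rw [Metric.mem_thickening_iff]
    refine ⟨f t, mem_range_self t, ?_⟩
    have : q t - f t = (ζ t - r * (Real.cos (2 * Real.pi * t) * α +
        Real.sin (2 * Real.pi * t) * β)) / (r * α) *
        Complex.exp (-((2 * Real.pi * t : ℝ) * Complex.I)) := by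
      simp only [q, f]
      field_simp
    rw [dist_eq_norm, this, norm_mul, norm_div, norm_mul, Complex.norm_real, Real.norm_of_nonneg
      hr.le, ← neg_mul, ← Complex.ofReal_neg, Complex.norm_exp_ofReal_mul_I, mul_one,
      div_lt_iff₀ (by positivity)]
    refine (hclose t).trans_lt ?_
    have : 0 < r * ‖α‖ * δ := by positivity
    nlinarith
  have hqc : Continuous q := by fun_prop
  refine ⟨fun t => ‖ζ t‖, fun t => α.arg / (2 * Real.pi) + t + (q t).arg / (2 * Real.pi),
    fun t => ?_, ?_, ?_, ?_⟩
  · rw [norm_pos_iff]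
    intro h0
    have := hq t
    simp [q, h0] at this
  · have : Continuous fun t => (q t).arg := continuous_iff_continuousAt.2 fun t =>
      (Complex.continuousAt_arg (hq t)).comp hqc.continuousAt
    fun_prop
  · have : q 1 = q 0 := by
      simp only [q, h01]
      congr 1
      simp only [Icc.coe_one, mul_one, Icc.coe_zero, mul_zero, Complex.ofReal_zero, zero_mul,
        neg_zero, Complex.exp_zero, Complex.exp_neg]
      push_cast
      rw [Complex.exp_two_pi_mul_I, inv_one]
    simp only [this, Icc.coe_one, Icc.coe_zero]
    ring
  · have key (t : I) : ζ t = ‖ζ t‖ * Complex.exp ((2 * Real.pi * (α.arg / (2 * Real.pi) + t +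
        (q t).arg / (2 * Real.pi)) : ℝ) * Complex.I) := by
      have e1 : ζ t = q t * (r * α) * Complex.exp ((2 * Real.pi * t : ℝ) * Complex.I) := by
        simp only [q]
        rw [div_mul_eq_mul_div, div_mul_cancel₀ _ (mul_ne_zero hr0 hα), mul_assoc,
          ← Complex.exp_add]
        simp
      have e2 : ‖ζ t‖ = ‖q t‖ * (r * ‖α‖) := by
        rw [e1, norm_mul, norm_mul (q t), norm_mul (r : ℂ), Complex.norm_exp_ofReal_mul_I, Complex.norm_real,
          Real.norm_of_nonneg hr.le, mul_one]
      have e3 : 2 * Real.pi * (α.arg / (2 * Real.pi) + t + (q t).arg / (2 * Real.pi)) =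
          α.arg + 2 * Real.pi * t + (q t).arg := by
        field_simp
      rw [e3, e2]
      conv_lhs => rw [e1, ← Complex.norm_mul_exp_arg_mul_I (q t), ← Complex.norm_mul_exp_arg_mul_I α]
      push_cast
      rw [add_mul, add_mul, Complex.exp_add, Complex.exp_add]
      ring
    constructor <;> intro t
    · have := congrArg Complex.re (key t)
      rwa [Complex.re_ofReal_mul, Complex.exp_ofReal_mul_I_re] at this
    · have := congrArg Complex.im (key t)
      rwa [Complex.im_ofReal_mul, Complex.exp_ofReal_mul_I_im] at this

variable {k m : ℕ} {J : OrientedLink k} {G : Type*} [Group G]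
  {F : Fin m → OrientedSurface} {g : Fin m → G}

/-- The vector of length `1` at angle `2πs` in the plane of the last two coordinates. -/
def transverseVector (s : ℝ) : E 3 :=
  Real.cos (2 * Real.pi * s) • EuclideanSpace.single 1 1 +
    Real.sin (2 * Real.pi * s) • EuclideanSpace.single 2 1

theorem norm_transverseVector (s : ℝ) : ‖transverseVector s‖ = 1 := by
  simp [EuclideanSpace.norm_eq, transverseVector, Fin.sum_univ_three]

/-- A sufficiently small meridian at a boundary point of `F i` has the value `g i`. -/
theorem IsCrossingHom.small_meridian {Φ : PathHom J.Complement G} (hΦ : IsCrossingHom F g Φ)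
    (hF : Pairwise fun i j => Disjoint (F i).carrier (F j).carrier)
    (hFJ : ∀ i, (F i).boundary ⊆ J.carrier)
    (hor : ∀ i e, (F i).IsChart e → ∀ y : J.carrier, (y : S3) ∈ e.source →
      e y 1 = 0 → e y 2 = 0 → ∃ c : ℝ, 0 < c ∧ coordVec e (e y) 0 = c • J.tangent y)
    {i : Fin m} {x : S3} (hx : x ∈ (F i).boundary) {e : OpenPartialHomeomorph S3 (E 3)}
    (he : J.IsChart e) (hxe : x ∈ e.source) :
    ∃ r₀ > (0 : ℝ), ∀ r : ℝ, 0 < r → r < r₀ → ∀ γ : C(I, J.Complement),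
      (∀ t : I, (γ t : S3) = e.symm (e x + r • transverseVector t)) → Φ.toFun γ = g i := by
  have hxF := (F i).boundary_subset hx
  obtain ⟨e', he', hxe', h1, h2⟩ := hx
  have hxJ : x ∈ J.carrier := hFJ i ⟨e', he', hxe', h1, h2⟩
  obtain ⟨L, hL, hLD⟩ := exists_hasFDerivAt_transition he.1 he'.1 hxe hxe'
  obtain ⟨c, hc, hcv⟩ := he.2.2 ⟨x, hxJ⟩ hxe
  obtain ⟨c', hc', hcv'⟩ := hor i e' he' ⟨x, hxJ⟩ hxe' h1 h2
  have hdet := transverse_det_pos he.1 he'.1 hxe hxe' hLD (c := c / c') (by positivity) (by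
    rw [hcv', smul_smul, div_mul_cancel₀ _ hc'.ne', hcv])
  let α : ℂ := ⟨L (EuclideanSpace.single 1 1) 1, L (EuclideanSpace.single 1 1) 2⟩
  let β : ℂ := ⟨L (EuclideanSpace.single 2 1) 1, L (EuclideanSpace.single 2 1) 2⟩
  obtain ⟨ε, hε, hwind⟩ := exists_polar_of_near_ellipse (α := α) (β := β) hdet
  have hsymm : Tendsto e.symm (𝓝 (e x)) (𝓝 x) := by
    have := e.continuousAt_symm (e.map_source hxe)
    rwa [ContinuousAt, e.left_inv hxe] at this
  have hgood := (hL.isLittleO.def hε).and ((hsymm.eventually (e'.open_source.mem_nhds hxe')).and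
    (hsymm.eventually (eventually_notMem_of_mem hF hxF)))
  obtain ⟨r₀, hr₀, hball⟩ := Metric.eventually_nhds_iff_ball.1 hgood
  refine ⟨r₀, hr₀, fun r hr hrr γ hγ => ?_⟩
  have hp (t : I) := hball (e x + r • transverseVector t) (by
    rw [mem_ball_iff_norm, add_sub_cancel_left, norm_smul, norm_transverseVector, mul_one,
      Real.norm_of_nonneg hr.le]
    exact hrr)
  have hγe (t : I) : (γ t : S3) ∈ e'.source := by rw [hγ]; exact (hp t).2.1
  have hcont (j : Fin 3) : Continuous fun t => e' (γ t) j := continuous_iff_continuousAt.2 fun t =>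
    ContinuousAt.comp (g := fun z => e' z j) (continuousAt_chart_apply (hγe t) j)
      (continuous_subtype_val.comp γ.continuous).continuousAt
  have hζ : Continuous fun t => (⟨e' (γ t) 1, e' (γ t) 2⟩ : ℂ) := by
    have : (fun t => (⟨e' (γ t) 1, e' (γ t) 2⟩ : ℂ)) =
        fun t => ((e' (γ t) 1 : ℝ) : ℂ) + (e' (γ t) 2 : ℝ) * Complex.I := by
      ext t : 1; exact Complex.mk_eq_add_mul_I _ _
    rw [this]
    exact (Complex.continuous_ofReal.comp (hcont 1)).add
      ((Complex.continuous_ofReal.comp (hcont 2)).mul continuous_const)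
  obtain ⟨ρ, θ, hρ, hθ, h01, hre, him⟩ := hwind (fun t => ⟨e' (γ t) 1, e' (γ t) 2⟩) r hζ
    hr
    (by
      have : (γ 0 : S3) = γ 1 := by rw [hγ, hγ]; simp [transverseVector]
      rw [this])
    (fun t => by
      have hb := (hp t).1
      rw [add_sub_cancel_left, norm_smul, norm_transverseVector, mul_one,
        Real.norm_of_nonneg hr.le, e.left_inv hxe, ← hγ t] at hb
      refine le_trans ?_ hb
      set v := e' (γ t) - e' x - L (r • transverseVector t) with hv
      have hv1 : v 1 = e' (γ t) 1 - r * (Real.cos (2 * Real.pi * t) * α.re +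
          Real.sin (2 * Real.pi * t) * β.re) := by
        simp [hv, h1, transverseVector, α, β, mul_add]
      have hv2 : v 2 = e' (γ t) 2 - r * (Real.cos (2 * Real.pi * t) * α.im +
          Real.sin (2 * Real.pi * t) * β.im) := by
        simp [hv, h2, transverseVector, α, β, mul_add]
      have heq : ((⟨e' (γ t) 1, e' (γ t) 2⟩ : ℂ) - r * (Real.cos (2 * Real.pi * t) * α +
          Real.sin (2 * Real.pi * t) * β)) = ⟨v 1, v 2⟩ := by
        rw [hv1, hv2]
        apply Complex.ext <;> simp [-Complex.ofReal_cos, -Complex.ofReal_sin]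
      rw [heq]
      refine le_of_sq_le_sq ?_ (norm_nonneg _)
      rw [EuclideanSpace.norm_sq_eq, Fin.sum_univ_three, ← Complex.normSq_eq_norm_sq,
        Complex.normSq_mk]
      simp only [Real.norm_eq_abs, sq_abs]
      nlinarith [sq_nonneg (v 0)])
  rw [hΦ.eq_zpow_of_polar hF hFJ he' γ hγe (fun t => by rw [hγ]; exact (hp t).2.2) ρ θ hρ hθ hre
    him, h01, Int.floor_add_one, add_sub_cancel_left, zpow_one]

end Winding

/-! ### Slabs around points of a link -/

section Slab

variable {k : ℕ} {J : OrientedLink k}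

/-- The point with coordinates `a` along and `v` transverse to the link. -/
def slabPoint (a : ℝ) (v : ℂ) : E 3 := !₂[a, v.re, v.im]

/-- The transverse coordinates, as a complex number. -/
def transverse (p : E 3) : ℂ := ⟨p 1, p 2⟩

@[simp] theorem slabPoint_zero (a : ℝ) (v : ℂ) : slabPoint a v 0 = a := rfl

@[simp] theorem transverse_slabPoint (a : ℝ) (v : ℂ) : transverse (slabPoint a v) = v := rfl

theorem slabPoint_transverse (p : E 3) : slabPoint (p 0) (transverse p) = p := by
  ext i; fin_cases i <;> rfl

theorem transverse_eq_zero {p : E 3} : transverse p = 0 ↔ p 1 = 0 ∧ p 2 = 0 := Complex.ext_iff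

theorem continuous_transverse : Continuous transverse := by
  have : transverse = fun p => ((p 1 : ℝ) : ℂ) + (p 2 : ℝ) * Complex.I := by
    ext p : 1; exact Complex.mk_eq_add_mul_I _ _
  rw [this]
  exact (Complex.continuous_ofReal.comp (by fun_prop)).add
    ((Complex.continuous_ofReal.comp (by fun_prop)).mul continuous_const)

theorem continuous_slabPoint : Continuous fun p : ℝ × ℂ => slabPoint p.1 p.2 := by
  refine (PiLp.continuous_toLp 2 _).comp (continuous_pi fun i => ?_)
  fin_cases i <;> simp <;> fun_prop

/-- `e` is a chart adapted to `J` at `x`, whose domain contains the product of an interval of radius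
`η` and a disc of radius `r`. -/
structure IsSlabChart (J : OrientedLink k) (e : OpenPartialHomeomorph S3 (E 3)) (x : S3)
    (η r : ℝ) : Prop where
  isChart : J.IsChart e
  mem_carrier : x ∈ J.carrier
  mem_source : x ∈ e.source
  η_pos : 0 < η
  r_pos : 0 < r
  mem_target : ∀ a v, |a - e x 0| < η → ‖v‖ < r → slabPoint a v ∈ e.target

/-- The open subset of the 3-sphere that corresponds to the product of an interval and a disc. -/
def slab (e : OpenPartialHomeomorph S3 (E 3)) (x : S3) (η r : ℝ) : Set S3 :=
  e.source ∩ e ⁻¹' {p | |p 0 - e x 0| < η ∧ ‖transverse p‖ < r}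

/-- Logarithmic polar coordinates on a slab minus the link. -/
def polarDomain (c η r : ℝ) : Set (ℝ × ℂ) := {p | |p.1 - c| < η ∧ p.2.re < Real.log r}

theorem convex_polarDomain (c η r : ℝ) : Convex ℝ (polarDomain c η r) := by
  have h1 : Convex ℝ {p : ℝ × ℂ | p.1 ∈ Metric.ball c η} :=
    (convex_ball c η).linear_preimage (LinearMap.fst ℝ ℝ ℂ)
  have h2 : Convex ℝ {p : ℝ × ℂ | p.2.re < Real.log r} :=
    (convex_Iio (Real.log r)).linear_preimage (Complex.reLm ∘ₗ LinearMap.snd ℝ ℝ ℂ)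
  exact h1.inter h2

theorem polarDomain_shift {c η r : ℝ} {p : ℝ × ℂ} (hp : p ∈ polarDomain c η r) (w : ℂ)
    (hw : w.re = 0) : (p.1, p.2 + w) ∈ polarDomain c η r :=
  ⟨hp.1, by simpa [hw] using hp.2⟩

theorem norm_exp_lt {r : ℝ} (hr : 0 < r) {w : ℂ} (hw : w.re < Real.log r) :
    ‖Complex.exp w‖ < r := by
  rw [Complex.norm_exp]
  exact (Real.lt_log_iff_exp_lt hr).1 hw

namespace IsSlabChart

variable {e : OpenPartialHomeomorph S3 (E 3)} {x : S3} {η r : ℝ}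

theorem mono (h : IsSlabChart J e x η r) {η' r' : ℝ} (h1 : 0 < η') (h2 : η' ≤ η) (h3 : 0 < r')
    (h4 : r' ≤ r) : IsSlabChart J e x η' r' :=
  ⟨h.isChart, h.mem_carrier, h.mem_source, h1, h3, fun a v ha hv =>
    h.mem_target a v (ha.trans_le h2) (hv.trans_le h4)⟩

theorem apply_eq (h : IsSlabChart J e x η r) : e x = slabPoint (e x 0) 0 := by
  have h0 := (h.isChart.2.1 x h.mem_source).1 h.mem_carrier
  rw [← transverse_eq_zero] at h0
  rw [← h0, slabPoint_transverse]

theorem isOpen_slab (e : OpenPartialHomeomorph S3 (E 3)) (x : S3) (η r : ℝ) :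
    IsOpen (slab e x η r) := by
  refine e.isOpen_inter_preimage ?_
  have h0 : Continuous fun p : E 3 => p 0 := by fun_prop
  exact (isOpen_lt (h0.sub continuous_const).abs continuous_const).inter
    (isOpen_lt continuous_transverse.norm continuous_const)

theorem mem_slab (h : IsSlabChart J e x η r) : x ∈ slab e x η r := by
  refine ⟨h.mem_source, ?_⟩
  change |e x 0 - e x 0| < η ∧ _
  rw [sub_self, abs_zero, h.apply_eq, transverse_slabPoint, norm_zero]
  exact ⟨h.η_pos, h.r_pos⟩

theorem notMem_carrier (h : IsSlabChart J e x η r) {a : ℝ} {v : ℂ} (hv : v ≠ 0)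
    (hp : slabPoint a v ∈ e.target) : e.symm (slabPoint a v) ∉ J.carrier := fun hJ => by
  have := (h.isChart.2.1 _ (e.map_target hp)).1 hJ
  rw [e.right_inv hp, ← transverse_eq_zero] at this
  exact hv this

theorem transverse_ne_zero (h : IsSlabChart J e x η r) {z : S3} (hz : z ∈ e.source)
    (hzJ : z ∉ J.carrier) : transverse (e z) ≠ 0 := fun h0 =>
  hzJ ((h.isChart.2.1 z hz).2 (transverse_eq_zero.1 h0))

/-- The universal covering of a slab minus the link. -/
def polarMap (h : IsSlabChart J e x η r) : C(polarDomain (e x 0) η r, J.Complement) where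
  toFun p := ⟨e.symm (slabPoint p.1.1 (Complex.exp p.1.2)), h.notMem_carrier (Complex.exp_ne_zero _)
    (h.mem_target _ _ p.2.1 (norm_exp_lt h.r_pos p.2.2))⟩
  continuous_toFun := by
    refine Continuous.subtype_mk ?_ _
    refine e.continuousOn_symm.comp_continuous ?_ fun p =>
      h.mem_target _ _ p.2.1 (norm_exp_lt h.r_pos p.2.2)
    exact continuous_slabPoint.comp (by fun_prop :
      Continuous fun p : polarDomain (e x 0) η r => (p.1.1, Complex.exp p.1.2))

theorem exists_lift (h : IsSlabChart J e x η r) (γ : C(I, J.Complement))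
    (hγ : ∀ t, (γ t : S3) ∈ slab e x η r) :
    ∃ δ : C(I, polarDomain (e x 0) η r), h.polarMap.comp δ = γ ∧
      ∀ t, (δ t).1.1 = e (γ t) 0 ∧ Complex.exp (δ t).1.2 = transverse (e (γ t)) := by
  have hec : Continuous fun t => e (γ t) :=
    e.continuousOn.comp_continuous (continuous_subtype_val.comp γ.continuous) fun t => (hγ t).1
  let v : C(I, {z : ℂ // z ≠ 0}) :=
    ⟨fun t => ⟨transverse (e (γ t)), h.transverse_ne_zero (hγ t).1 (γ t).2⟩,
      (continuous_transverse.comp hec).subtype_mk _⟩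
  have hv0 : v 0 = (⟨Complex.exp (Complex.log (v 0)), Complex.exp_ne_zero _⟩ : {z : ℂ // z ≠ 0}) :=
    Subtype.ext (Complex.exp_log (v 0).2).symm
  let w := Complex.isCoveringMap_exp.liftPath v (Complex.log (v 0)) hv0
  have hw (t : I) : Complex.exp (w t) = transverse (e (γ t)) :=
    congrArg Subtype.val (congrFun (Complex.isCoveringMap_exp.liftPath_lifts v _ hv0) t)
  have hmem (t : I) : (e (γ t) 0, w t) ∈ polarDomain (e x 0) η r := by
    refine ⟨(hγ t).2.1, ?_⟩
    rw [Real.lt_log_iff_exp_lt h.r_pos, ← Complex.norm_exp, hw]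
    exact (hγ t).2.2
  refine ⟨⟨fun t => ⟨(e (γ t) 0, w t), hmem t⟩, ?_⟩, ?_, fun t => ⟨rfl, hw t⟩⟩
  · have h0 : Continuous fun p : E 3 => p 0 := by fun_prop
    exact ((h0.comp hec).prodMk w.continuous).subtype_mk _
  · ext t : 2
    change e.symm (slabPoint (e (γ t) 0) (Complex.exp (w t))) = γ t
    rw [hw, slabPoint_transverse, e.left_inv (hγ t).1]

theorem slabPoint_add (h : IsSlabChart J e x η r) (s t : ℝ) :
    e x + s • transverseVector t = slabPoint (e x 0)
      (s * Complex.exp ((2 * Real.pi * t : ℝ) * Complex.I)) := by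
  conv_lhs => rw [h.apply_eq]
  ext i
  fin_cases i
  · simp [slabPoint, transverseVector]
  · simp [slabPoint, transverseVector, Complex.exp_ofReal_mul_I_re, -Complex.ofReal_mul]
  · simp [slabPoint, transverseVector, Complex.exp_ofReal_mul_I_im, -Complex.ofReal_mul]

theorem isPathConnected_polarDomain (h : IsSlabChart J e x η r) :
    IsPathConnected (polarDomain (e x 0) η r) :=
  (convex_polarDomain _ _ _).isPathConnected ⟨(e x 0, (Real.log r - 1 : ℝ)), by
    simpa using h.η_pos, by simp⟩

/-- The value of a homomorphism to a commutative group on the meridians of radius `s` does not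
depend on `s`. If it is trivial, then the homomorphism has a primitive near `x`. -/
theorem exists_period (h : IsSlabChart J e x η r) {G : Type*} [CommGroup G]
    (ψ : PathHom J.Complement G) : ∃ c : G,
      (∀ s, 0 < s → s < r → ∀ γ : C(I, J.Complement),
        (∀ t : I, (γ t : S3) = e.symm (e x + s • transverseVector t)) → ψ.toFun γ = c) ∧
      (c = 1 → ∃ l, ψ.IsPrimitiveOn l ((↑) ⁻¹' slab e x η r)) := by
  let P := polarDomain (e x 0) η r
  have hPc := h.isPathConnected_polarDomain
  have : ContractibleSpace P := (convex_polarDomain _ _ _).contractibleSpace hPc.nonempty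
  obtain ⟨l, hl⟩ := (ψ.comap h.polarMap).exists_primitive
  have hre : ((2 * Real.pi : ℝ) * Complex.I : ℂ).re = 0 := by simp
  let τ (p : P) : P := ⟨(p.1.1, p.1.2 + (2 * Real.pi : ℝ) * Complex.I), polarDomain_shift p.2 _ hre⟩
  have hτ : Continuous τ := by fun_prop
  have hτq (p : P) : h.polarMap (τ p) = h.polarMap p := by
    refine Subtype.ext ?_
    change e.symm (slabPoint _ (Complex.exp (_ + _))) = e.symm _
    rw [Complex.exp_add]
    congr 3
    push_cast
    rw [Complex.exp_two_pi_mul_I, mul_one]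
  -- the deck transformation `τ` changes the primitive by a constant factor
  have hshift (p p' : P) : l (τ p) / l p = l (τ p') / l p' := by
    have γ : Path p p' := PathConnectedSpace.somePath p p'
    have h1 := hl γ.toContinuousMap fun _ => trivial
    have h2 := hl (γ.map hτ).toContinuousMap fun _ => trivial
    have h3 : h.polarMap.comp (γ.map hτ).toContinuousMap = h.polarMap.comp γ.toContinuousMap := by
      ext t : 1; exact hτq (γ t)
    change ψ.toFun (h.polarMap.comp (γ.map hτ).toContinuousMap) = _ at h2
    rw [h3] at h2
    have h4 := h1.symm.trans h2
    simp only [Path.coe_toContinuousMap, Path.source, Path.target] at h4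
    rw [inv_mul_eq_div, inv_mul_eq_div] at h4
    rw [div_eq_div_iff_mul_eq_mul] at h4 ⊢
    rw [mul_comm, ← h4, mul_comm]
  obtain ⟨p₀, hp₀⟩ := hPc.nonempty
  refine ⟨l (τ ⟨p₀, hp₀⟩) / l ⟨p₀, hp₀⟩, fun s hs hsr γ hγ => ?_, fun hc => ?_⟩
  · have hmem (t : ℝ) : (e x 0, ((Real.log s : ℝ) : ℂ) + (2 * Real.pi * t : ℝ) * Complex.I) ∈
        polarDomain (e x 0) η r := by
      refine ⟨by simpa using h.η_pos, ?_⟩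
      simpa using Real.log_lt_log hs hsr
    let δ : C(I, P) := ⟨fun t => ⟨_, hmem t⟩, by fun_prop⟩
    have h1 := hl δ fun _ => trivial
    have h2 : h.polarMap.comp δ = γ := by
      ext t : 2
      rw [hγ, h.slabPoint_add]
      change e.symm (slabPoint _ (Complex.exp (_ + _))) = _
      rw [Complex.exp_add, ← Complex.ofReal_exp, Real.exp_log hs]
      rfl
    change ψ.toFun (h.polarMap.comp δ) = _ at h1
    have h3 : δ 1 = τ (δ 0) := by
      refine Subtype.ext (Prod.ext rfl ?_)
      simp [δ, τ]
    rw [← h2, h1, h3, hshift _ (δ 0), inv_mul_eq_div]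
  · have hper (p : P) : l (τ p) = l p := by
      have := hshift p ⟨p₀, hp₀⟩
      rwa [hc, div_eq_one] at this
    have hpern (n : ℤ) (a : ℝ) (w : ℂ) (h1 : (a, w) ∈ P)
        (h2 : (a, w + n * (2 * Real.pi * Complex.I)) ∈ P) : l ⟨_, h2⟩ = l ⟨_, h1⟩ := by
      induction n using Int.induction_on with
      | zero => simp
      | succ n ih =>
        have h3 : (a, w + (n : ℤ) * (2 * Real.pi * Complex.I)) ∈ P :=
          polarDomain_shift h1 _ (by simp)
        rw [← ih h3, ← hper ⟨_, h3⟩]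
        congr 1
        refine Subtype.ext (Prod.ext rfl ?_)
        simp only [τ]; push_cast; ring
      | pred n ih =>
        have h3 : (a, w + (-n : ℤ) * (2 * Real.pi * Complex.I)) ∈ P :=
          polarDomain_shift h1 _ (by simp)
        rw [← ih h3, ← hper ⟨_, h2⟩]
        congr 1
        refine Subtype.ext (Prod.ext rfl ?_)
        simp only [τ]; push_cast; ring
    classical
    refine ⟨fun z => if hz : (e z 0, Complex.log (transverse (e z))) ∈ P then l ⟨_, hz⟩ else 1,
      fun γ hγ => ?_⟩
    obtain ⟨δ, hδ, hδ'⟩ := h.exists_lift γ hγ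
    have h1 := hl δ fun _ => trivial
    change ψ.toFun (h.polarMap.comp δ) = _ at h1
    rw [hδ] at h1
    have key (t : I) : (if hz : (e (γ t) 0, Complex.log (transverse (e (γ t)))) ∈ P then
        l ⟨_, hz⟩ else 1) = l (δ t) := by
      have hne := h.transverse_ne_zero (hγ t).1 (γ t).2
      have hz : (e (γ t) 0, Complex.log (transverse (e (γ t)))) ∈ P := by
        refine ⟨(hγ t).2.1, ?_⟩
        rw [Complex.log_re]
        exact Real.log_lt_log (norm_pos_iff.2 hne) (hγ t).2.2
      rw [dif_pos hz]
      obtain ⟨n, hn⟩ := Complex.exp_eq_exp_iff_exists_int.1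
        ((hδ' t).2.trans (Complex.exp_log hne).symm)
      have h2 : (e (γ t) 0, Complex.log (transverse (e (γ t))) + n * (2 * Real.pi * Complex.I)) ∈ P :=
        polarDomain_shift hz _ (by simp)
      rw [← hpern n _ _ hz h2]
      congr 1
      exact Subtype.ext (Prod.ext (hδ' t).1.symm hn.symm)
    exact h1.trans (by simp only [key])

/-- A slab minus the link is path connected. -/
theorem isPathConnected_slab (h : IsSlabChart J e x η r) :
    IsPathConnected ((↑) ⁻¹' slab e x η r : Set J.Complement) := by
  have := isPathConnected_iff_pathConnectedSpace.1 h.isPathConnected_polarDomain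
  convert isPathConnected_range h.polarMap.continuous using 1
  ext z
  constructor
  · intro hz
    obtain ⟨δ, hδ, -⟩ := h.exists_lift (.const I z) fun _ => hz
    exact ⟨δ 0, DFunLike.congr_fun hδ 0⟩
  · rintro ⟨p, rfl⟩
    have ht := h.mem_target _ _ p.2.1 (norm_exp_lt h.r_pos p.2.2)
    refine ⟨e.map_target ht, ?_⟩
    change _ ∧ _
    simp only [polarMap, ContinuousMap.coe_mk, e.right_inv ht, slabPoint_zero,
      transverse_slabPoint]
    exact ⟨p.2.1, norm_exp_lt h.r_pos p.2.2⟩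

/-- The circles around a point of the link, in an adapted chart. -/
theorem exists_circle (h : IsSlabChart J e x η r) {s : ℝ} (hs : 0 < s) (hsr : s < r) :
    ∃ γ : C(I, J.Complement), ∀ t : I, (γ t : S3) = e.symm (e x + s • transverseVector t) := by
  have hmem (t : ℝ) : (e x 0, ((Real.log s : ℝ) : ℂ) + (2 * Real.pi * t : ℝ) * Complex.I) ∈
      polarDomain (e x 0) η r := by
    refine ⟨by simpa using h.η_pos, ?_⟩
    simpa using Real.log_lt_log hs hsr
  refine ⟨h.polarMap.comp ⟨fun t => ⟨_, hmem t⟩, by fun_prop⟩, fun t => ?_⟩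
  rw [h.slabPoint_add]
  change e.symm (slabPoint _ (Complex.exp (_ + _))) = _
  rw [Complex.exp_add, ← Complex.ofReal_exp, Real.exp_log hs]
  rfl

/-- The slabs form a basis of neighbourhoods. -/
theorem exists_slab_subset (h : IsSlabChart J e x η r) {U : Set S3} (hU : U ∈ 𝓝 x) :
    ∃ ε, IsSlabChart J e x ε ε ∧ slab e x ε ε ⊆ U := by
  have hsymm : Tendsto (fun p : ℝ × ℂ => e.symm (slabPoint p.1 p.2)) (𝓝 (e x 0, 0)) (𝓝 x) := by
    have h1 := e.continuousAt_symm (e.map_source h.mem_source)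
    rw [ContinuousAt, e.left_inv h.mem_source] at h1
    refine h1.comp ?_
    have := continuous_slabPoint.tendsto (e x 0, (0 : ℂ))
    rwa [← h.apply_eq] at this
  obtain ⟨ε, hε, hb⟩ := Metric.mem_nhds_iff.1 (hsymm hU)
  have hm : 0 < min ε (min η r) := lt_min hε (lt_min h.η_pos h.r_pos)
  refine ⟨_, h.mono hm ((min_le_right _ _).trans (min_le_left _ _)) hm
    ((min_le_right _ _).trans (min_le_right _ _)), ?_⟩
  rintro z ⟨hz, h1, h2⟩
  have hmem : (e z 0, transverse (e z)) ∈ Metric.ball (e x 0, (0 : ℂ)) ε := by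
    rw [Metric.mem_ball, Prod.dist_eq, max_lt_iff, Real.dist_eq, dist_zero_right]
    exact ⟨h1.trans_le (min_le_left _ _), h2.trans_le (min_le_left _ _)⟩
  have := hb hmem
  simpa [slabPoint_transverse, e.left_inv hz] using this

end IsSlabChart

end Slab

/-! ### Tubular neighbourhoods -/

namespace TubularNeighborhood

variable {k : ℕ} {J : OrientedLink k} (N : TubularNeighborhood J)

theorem norm_complexVec (v : ℂ) : ‖(!₂[v.re, v.im] : E 2)‖ = ‖v‖ := by
  rw [EuclideanSpace.norm_eq, Complex.norm_eq_sqrt_sq_add_sq]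
  simp

/-- The parametrization of the tubular neighbourhood, with a complex transverse coordinate. -/
def tubePoint (x : J.carrier) (v : ℂ) : S3 := N.toFun x !₂[v.re, v.im]

theorem tubePoint_injective {x y : J.carrier} {v w : ℂ} (hv : ‖v‖ < 2) (hw : ‖w‖ < 2)
    (h : N.tubePoint x v = N.tubePoint y w) : x = y ∧ v = w := by
  obtain ⟨h1, h2⟩ := N.injective x y _ _ (by rwa [norm_complexVec]) (by rwa [norm_complexVec]) h
  refine ⟨h1, Complex.ext ?_ ?_⟩
  · simpa using congrArg (fun u : E 2 => u 0) h2
  · simpa using congrArg (fun u : E 2 => u 1) h2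

theorem mem_openTube {z : S3} : z ∈ N.openTube ↔ ∃ x v, ‖v‖ < 1 ∧ N.tubePoint x v = z := by
  constructor
  · rintro ⟨x, v, hv, rfl⟩
    have hv' : (!₂[(⟨v 0, v 1⟩ : ℂ).re, (⟨v 0, v 1⟩ : ℂ).im] : E 2) = v := by
      ext i; fin_cases i <;> rfl
    refine ⟨x, ⟨v 0, v 1⟩, ?_, ?_⟩
    · rwa [← norm_complexVec, hv']
    · rw [tubePoint, hv']
  · rintro ⟨x, v, hv, rfl⟩
    exact ⟨x, _, by rwa [norm_complexVec], rfl⟩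

theorem tubePoint_mem_openTube_iff {x : J.carrier} {v : ℂ} (hv : ‖v‖ < 2) :
    N.tubePoint x v ∈ N.openTube ↔ ‖v‖ < 1 := by
  rw [mem_openTube]
  constructor
  · rintro ⟨y, w, hw, h⟩
    rw [← (N.tubePoint_injective (by linarith) hv h).2]
    exact hw
  · exact fun h => ⟨x, v, h, rfl⟩

/-- `e` is a chart at `x` in which the tubular neighbourhood is a standard one. -/
structure IsTubeChart (e : OpenPartialHomeomorph S3 (E 3)) (x : S3) : Prop where
  exists_slab : ∃ η, IsSlabChart J e x η 2
  norm_lt : ∀ z ∈ e.source, ‖transverse (e z)‖ < 2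
  mem_target : ∀ z ∈ e.source, ∀ v, ‖v‖ < 2 → slabPoint (e z 0) v ∈ e.target
  tubePoint_eq : ∀ y : J.carrier, (y : S3) ∈ e.source → ∀ v, ‖v‖ < 2 →
    N.tubePoint y v = e.symm (slabPoint (e y 0) v)

theorem exists_isTubeChart (x : J.carrier) : ∃ e, N.IsTubeChart e x := by
  obtain ⟨e, he, hx, ⟨A, hA⟩, h⟩ := N.exists_chart x
  have hmem (a : ℝ) (v : ℂ) : slabPoint a v ∈ e.target ↔ a ∈ A ∧ ‖v‖ < 2 := by
    rw [hA, ← norm_complexVec]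
    rfl
  have hA' : ∀ z ∈ e.source, e z 0 ∈ A ∧ ‖transverse (e z)‖ < 2 := fun z hz => by
    rw [← hmem, slabPoint_transverse]
    exact e.map_source hz
  have hopen : IsOpen {a : ℝ | slabPoint a 0 ∈ e.target} :=
    e.open_target.preimage (continuous_slabPoint.comp (by fun_prop :
      Continuous fun a : ℝ => (a, (0 : ℂ))))
  obtain ⟨η, hη, hb⟩ := Metric.isOpen_iff.1 hopen (e x 0) ((hmem _ _).2 ⟨(hA' x hx).1, by simp⟩)
  refine ⟨e, ⟨η, he, x.2, hx, hη, by norm_num, fun a v ha hv => ?_⟩, fun z hz => (hA' z hz).2,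
    fun z hz v hv => (hmem _ _).2 ⟨(hA' z hz).1, hv⟩, fun y hy v hv => ?_⟩
  · exact (hmem _ _).2 ⟨((hmem _ _).1 (hb (by rwa [Metric.mem_ball, Real.dist_eq]))).1, hv⟩
  · exact h y hy _ (by rwa [norm_complexVec])

variable {N} {e : OpenPartialHomeomorph S3 (E 3)} {x : S3}

theorem IsTubeChart.isChart (h : N.IsTubeChart e x) : J.IsChart e := h.exists_slab.choose_spec.isChart

theorem IsTubeChart.mem_source (h : N.IsTubeChart e x) : x ∈ e.source :=
  h.exists_slab.choose_spec.mem_source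

theorem IsTubeChart.exists_tubePoint (h : N.IsTubeChart e x) {z : S3} (hz : z ∈ e.source) :
    ∃ y : J.carrier, (y : S3) ∈ e.source ∧ e y 0 = e z 0 ∧
      N.tubePoint y (transverse (e z)) = z := by
  have h0 := h.mem_target z hz 0 (by simp)
  have hy : e.symm (slabPoint (e z 0) 0) ∈ J.carrier := by
    refine (h.isChart.2.1 _ (e.map_target h0)).2 ?_
    rw [e.right_inv h0, ← transverse_eq_zero, transverse_slabPoint]
  have hy0 : e (e.symm (slabPoint (e z 0) 0)) 0 = e z 0 := by rw [e.right_inv h0]; rfl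
  refine ⟨⟨_, hy⟩, e.map_target h0, hy0, ?_⟩
  rw [h.tubePoint_eq _ (e.map_target h0) _ (h.norm_lt z hz), hy0, slabPoint_transverse,
    e.left_inv hz]

variable (N)

theorem tubePoint_zero (x : J.carrier) : N.tubePoint x 0 = x := by
  obtain ⟨e, he⟩ := N.exists_isTubeChart x
  obtain ⟨η, hη⟩ := he.exists_slab
  rw [he.tubePoint_eq x he.mem_source 0 (by simp), ← hη.apply_eq, e.left_inv he.mem_source]

theorem carrier_subset_openTube : J.carrier ⊆ N.openTube := fun x hx =>
  N.mem_openTube.2 ⟨⟨x, hx⟩, 0, by simp, N.tubePoint_zero _⟩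

theorem continuousAt_tubePoint (x : J.carrier) {v : ℂ} (hv : ‖v‖ < 2) :
    ContinuousAt (fun p : J.carrier × ℂ => N.tubePoint p.1 p.2) (x, v) := by
  obtain ⟨e, he⟩ := N.exists_isTubeChart x
  have h1 : ContinuousAt (fun p : J.carrier × ℂ => e.symm (slabPoint (e p.1 0) p.2)) (x, v) := by
    refine ContinuousAt.comp (g := e.symm)
      (e.continuousAt_symm (he.mem_target x he.mem_source v hv)) ?_
    refine ContinuousAt.comp (g := fun p : ℝ × ℂ => slabPoint p.1 p.2)
      continuous_slabPoint.continuousAt (ContinuousAt.prodMk ?_ continuousAt_snd)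
    exact ContinuousAt.comp (g := fun z => e z 0) (continuousAt_chart_apply he.mem_source 0)
      (continuous_subtype_val.comp continuous_fst).continuousAt
  refine h1.congr ?_
  have h2 : ∀ᶠ p : J.carrier × ℂ in 𝓝 (x, v), (p.1 : S3) ∈ e.source :=
    (continuous_subtype_val.comp continuous_fst).continuousAt.eventually
      (e.open_source.eventually_mem he.mem_source)
  have h3 : ∀ᶠ p : J.carrier × ℂ in 𝓝 (x, v), ‖p.2‖ < 2 :=
    (continuous_snd.norm).continuousAt.eventually (gt_mem_nhds hv)
  filter_upwards [h2, h3] with p hp hp'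
  exact (he.tubePoint_eq _ hp _ hp').symm

theorem isClosed_closedTube : IsClosed {z | ∃ x v, ‖v‖ ≤ 1 ∧ N.tubePoint x v = z} := by
  have := isCompact_iff_compactSpace.1 J.isCompact_carrier
  have hK : IsCompact ((univ : Set J.carrier) ×ˢ Metric.closedBall (0 : ℂ) 1) :=
    isCompact_univ.prod (isCompact_closedBall _ _)
  have hc : ContinuousOn (fun p : J.carrier × ℂ => N.tubePoint p.1 p.2)
      ((univ : Set J.carrier) ×ˢ Metric.closedBall (0 : ℂ) 1) := fun p hp =>
    (N.continuousAt_tubePoint p.1 (by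
      have : ‖p.2‖ ≤ 1 := by simpa using hp.2
      linarith)).continuousWithinAt
  convert (hK.image_of_continuousOn hc).isClosed using 1
  ext z
  constructor
  · rintro ⟨x, v, hv, rfl⟩
    exact ⟨(x, v), ⟨trivial, by simpa using hv⟩, rfl⟩
  · rintro ⟨⟨x, v⟩, ⟨-, hv⟩, rfl⟩
    exact ⟨x, v, by simpa using hv, rfl⟩

/-- The radial retraction of the punctured plane onto the complement of the open unit disc. -/
def radial (v : ℂ) : ℂ := (max 1 ‖v‖⁻¹ : ℝ) * v

theorem norm_radial_lt {v : ℂ} (hv : ‖v‖ < 2) : ‖radial v‖ < 2 := by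
  rw [radial, norm_mul, Complex.norm_real, Real.norm_of_nonneg (by positivity)]
  rcases le_total ‖v‖⁻¹ 1 with h | h
  · rwa [max_eq_left h, one_mul]
  · rw [max_eq_right h]
    exact inv_mul_le_one.trans_lt (by norm_num)

theorem one_le_norm_radial {v : ℂ} (hv : v ≠ 0) : 1 ≤ ‖radial v‖ := by
  rw [radial, norm_mul, Complex.norm_real, Real.norm_of_nonneg (by positivity)]
  calc (1 : ℝ) = ‖v‖⁻¹ * ‖v‖ := (inv_mul_cancel₀ (norm_ne_zero_iff.2 hv)).symm
    _ ≤ _ := by gcongr; exact le_max_right _ _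

theorem radial_of_one_le {v : ℂ} (hv : 1 ≤ ‖v‖) : radial v = v := by
  rw [radial, max_eq_left (inv_le_one_of_one_le₀ hv)]
  simp

theorem continuousAt_radial {v : ℂ} (hv : v ≠ 0) : ContinuousAt radial v := by
  have : ContinuousAt (fun v : ℂ => max 1 ‖v‖⁻¹) v :=
    continuousAt_const.max (continuous_norm.continuousAt.inv₀ (norm_ne_zero_iff.2 hv))
  exact (Complex.continuous_ofReal.continuousAt.comp this).mul continuousAt_id

open Classical in
/-- The retraction of the complement of the link onto the exterior, which moves the points of the
tubular neighbourhood radially to its boundary. On the link itself it is the identity. -/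
def retract (z : S3) : S3 :=
  if h : ∃ p : J.carrier × ℂ, ‖p.2‖ < 2 ∧ N.tubePoint p.1 p.2 = z then
    N.tubePoint h.choose.1 (radial h.choose.2) else z

theorem retract_tubePoint (x : J.carrier) {v : ℂ} (hv : ‖v‖ < 2) :
    N.retract (N.tubePoint x v) = N.tubePoint x (radial v) := by
  have h : ∃ p : J.carrier × ℂ, ‖p.2‖ < 2 ∧ N.tubePoint p.1 p.2 = N.tubePoint x v :=
    ⟨(x, v), hv, rfl⟩
  obtain ⟨h1, h2⟩ := N.tubePoint_injective h.choose_spec.1 hv h.choose_spec.2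
  rw [retract, dif_pos h, h1, h2]

theorem retract_of_notMem {z : S3} (hz : z ∉ N.openTube) : N.retract z = z := by
  by_cases h : ∃ p : J.carrier × ℂ, ‖p.2‖ < 2 ∧ N.tubePoint p.1 p.2 = z
  · obtain ⟨⟨x, v⟩, hv, rfl⟩ := h
    rw [N.tubePoint_mem_openTube_iff hv, not_lt] at hz
    rw [N.retract_tubePoint x hv, radial_of_one_le hz]
  · exact dif_neg h

theorem retract_notMem {z : S3} (hz : z ∉ J.carrier) : N.retract z ∉ N.openTube := by
  by_cases h : ∃ p : J.carrier × ℂ, ‖p.2‖ < 2 ∧ N.tubePoint p.1 p.2 = z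
  · obtain ⟨⟨x, v⟩, hv, rfl⟩ := h
    have hv0 : v ≠ 0 := by
      rintro rfl
      rw [N.tubePoint_zero] at hz
      exact hz x.2
    rw [N.retract_tubePoint x hv, N.tubePoint_mem_openTube_iff (norm_radial_lt hv), not_lt]
    exact one_le_norm_radial hv0
  · have h1 : z ∉ N.openTube := fun h2 => by
      obtain ⟨x, v, hv, hz⟩ := N.mem_openTube.1 h2
      exact h ⟨(x, v), by simpa using by linarith, hz⟩
    rwa [N.retract_of_notMem h1]

theorem continuousAt_retract {z : S3} (hz : z ∉ J.carrier) : ContinuousAt N.retract z := by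
  by_cases h : ∃ x v, ‖v‖ ≤ 1 ∧ N.tubePoint x v = z
  · obtain ⟨x, v, hv, rfl⟩ := h
    obtain ⟨e, he⟩ := N.exists_isTubeChart x
    have hv2 : ‖v‖ < 2 := by linarith
    have htarget := he.mem_target x he.mem_source v hv2
    have hsource : N.tubePoint x v ∈ e.source := by
      rw [he.tubePoint_eq x he.mem_source v hv2]
      exact e.map_target htarget
    have heq : ∀ᶠ y in 𝓝 (N.tubePoint x v), N.retract y =
        e.symm (slabPoint (e y 0) (radial (transverse (e y)))) := by
      filter_upwards [e.open_source.mem_nhds hsource] with y hy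
      obtain ⟨u, hu, hu0, huy⟩ := he.exists_tubePoint hy
      conv_lhs => rw [← huy]
      rw [N.retract_tubePoint u (he.norm_lt y hy),
        he.tubePoint_eq u hu _ (norm_radial_lt (he.norm_lt y hy)), hu0]
    refine ContinuousAt.congr ?_ (heq.mono fun y hy => hy.symm)
    have hne : transverse (e (N.tubePoint x v)) ≠ 0 := by
      obtain ⟨η, hη⟩ := he.exists_slab
      exact hη.transverse_ne_zero hsource hz
    refine ContinuousAt.comp (g := e.symm) (e.continuousAt_symm
      (he.mem_target _ hsource _ (norm_radial_lt (he.norm_lt _ hsource)))) ?_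
    refine ContinuousAt.comp (g := fun p : ℝ × ℂ => slabPoint p.1 p.2)
      continuous_slabPoint.continuousAt
      (ContinuousAt.prodMk (continuousAt_chart_apply hsource 0) ?_)
    exact ContinuousAt.comp (g := radial) (continuousAt_radial hne)
      (continuous_transverse.continuousAt.comp (e.continuousAt hsource))
  · refine ContinuousAt.congr continuousAt_id ?_
    filter_upwards [N.isClosed_closedTube.isOpen_compl.mem_nhds h] with y hy
    refine (N.retract_of_notMem fun h2 => hy ?_).symm
    obtain ⟨x, v, hv, hz⟩ := N.mem_openTube.1 h2
    exact ⟨x, v, hv.le, hz⟩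

/-- The retraction of the complement of the link onto the exterior. -/
def toExterior : C(J.Complement, N.Exterior) where
  toFun z := ⟨N.retract z, N.retract_notMem z.2⟩
  continuous_toFun := (continuous_iff_continuousAt.2 fun z =>
    (N.continuousAt_retract z.2).comp continuous_subtype_val.continuousAt).subtype_mk _

/-- The inclusion of the exterior into the complement of the link. -/
def toComplement : C(N.Exterior, J.Complement) where
  toFun z := ⟨z, fun h => z.2 (N.carrier_subset_openTube h)⟩
  continuous_toFun := continuous_subtype_val.subtype_mk _

theorem toExterior_toComplement (z : N.Exterior) : N.toExterior (N.toComplement z) = z :=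
  Subtype.ext (N.retract_of_notMem z.2)

theorem meridian_apply (x : J.carrier) (t : I) :
    (N.meridian x t : S3) = N.tubePoint x (Complex.exp ((2 * Real.pi * t : ℝ) * Complex.I)) := by
  rw [tubePoint, Complex.exp_ofReal_mul_I_re, Complex.exp_ofReal_mul_I_im]
  rfl

theorem meridian_apply_chart {x : J.carrier} (he : N.IsTubeChart e x) (t : I) :
    (N.meridian x t : S3) = e.symm (e x + (1 : ℝ) • transverseVector t) := by
  obtain ⟨η, hη⟩ := he.exists_slab
  rw [meridian_apply, hη.slabPoint_add, he.tubePoint_eq x he.mem_source _ (by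
    rw [Complex.norm_exp_ofReal_mul_I]; norm_num), Complex.ofReal_one, one_mul]

end TubularNeighborhood

/-! ### Homomorphisms on the complement of a link in the 3-sphere -/

section Complement

instance : PreconnectedSpace S3 :=
  Subtype.preconnectedSpace (isPreconnected_sphere (by
    rw [rank_eq_card_basis (EuclideanSpace.basisFun (Fin 4) ℝ).toBasis]; simp) _ _)

/-- The subset `A` does not locally separate the space `X`: the points of `X` (including those of
`A`) have arbitrarily small neighbourhoods that are path connected after removing `A`. -/
def IsLocallyNonseparating {X : Type*} [TopologicalSpace X] (A : Set X) : Prop :=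
  ∀ x : X, ∀ U ∈ 𝓝 x, ∃ V ∈ 𝓝 x, V ⊆ U ∧ IsPathConnected ((↑) ⁻¹' V : Set {z // z ∉ A})

namespace IsLocallyNonseparating

variable {X G : Type*} [TopologicalSpace X] {A : Set X}

theorem neBot (hA : IsLocallyNonseparating A) (x : X) :
    (comap ((↑) : {z // z ∉ A} → X) (𝓝 x)).NeBot := by
  refine comap_neBot fun U hU => ?_
  obtain ⟨V, -, hVU, hV⟩ := hA x U hU
  obtain ⟨z, hz⟩ := hV.nonempty
  exact ⟨z, hVU hz⟩

theorem pathConnectedSpace [PreconnectedSpace X] [Nonempty X] (hA : IsLocallyNonseparating A) :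
    PathConnectedSpace {z // z ∉ A} := by
  have hne : Nonempty {z // z ∉ A} := by
    obtain ⟨x⟩ := ‹Nonempty X›
    have := hA.neBot x
    exact (comap ((↑) : {z // z ∉ A} → X) (𝓝 x)).nonempty_of_neBot
  refine ⟨hne, fun p q => ?_⟩
  -- whether the points near `x` belong to the path component of `p` does not depend on `x`
  have key (x : X) {V : Set X} (hV : V ∈ 𝓝 x) (hVc : IsPathConnected ((↑) ⁻¹' V : Set {z // z ∉ A})) :
      (∀ᶠ z : {z // z ∉ A} in comap (↑) (𝓝 x), Joined p z) ↔
        ∀ z : {z // z ∉ A}, (z : X) ∈ V → Joined p z := by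
    constructor
    · intro h z hz
      have := hA.neBot x
      obtain ⟨y, hy, hyV⟩ := (h.and (preimage_mem_comap hV)).exists
      exact hy.trans (hVc.joinedIn y hyV z hz).joined
    · exact fun h => mem_of_superset (preimage_mem_comap hV) h
  have hloc : IsLocallyConstant fun x : X => ∀ᶠ z : {z // z ∉ A} in comap (↑) (𝓝 x), Joined p z :=
    (IsLocallyConstant.iff_eventually_eq _).2 fun x => by
      obtain ⟨V, hV, -, hVc⟩ := hA x univ univ_mem
      filter_upwards [eventually_mem_nhds_iff.2 hV] with y hy
      exact propext ((key y hy hVc).trans (key x hV hVc).symm)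
  have hp : ∀ᶠ z : {z // z ∉ A} in comap (↑) (𝓝 (p : X)), Joined p z := by
    obtain ⟨V, hV, -, hVc⟩ := hA p univ univ_mem
    exact (key p hV hVc).2 fun z hz => (hVc.joinedIn p (mem_of_mem_nhds hV : (p : X) ∈ V) z hz).joined
  have hq : ∀ᶠ z : {z // z ∉ A} in comap (↑) (𝓝 (q : X)), Joined p z :=
    (hloc.apply_eq_of_preconnectedSpace (p : X) q).mp hp
  rw [← nhds_subtype_eq_comap] at hq
  exact hq.self_of_nhds

/-- A homomorphism on the complement of `A` that has primitives near all points of the ambient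
space, including those of `A`, has a global primitive if the ambient space is simply connected. -/
theorem exists_primitive [LocallyPathConnectedSpace X] [CommGroup G]
    (hX : ∀ ψ : PathHom X G, ∃ k, ψ.IsPrimitiveOn k univ)
    (hA : IsLocallyNonseparating A) (ψ : PathHom {z // z ∉ A} G)
    (h : ∀ x : X, ∃ U ∈ 𝓝 x, ∃ k, ψ.IsPrimitiveOn k ((↑) ⁻¹' U)) :
    ∃ k, ψ.IsPrimitiveOn k univ := by
  classical
  choose U hU k hk using h
  let C (x y : X) (c : G) : Prop :=
    ∀ᶠ z : {z // z ∉ A} in comap (↑) (𝓝 y), k x z = c * k y z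
  have hex (x : X) : ∀ᶠ y in 𝓝 x, ∃ c, C x y c := by
    filter_upwards [eventually_mem_nhds_iff.2 (hU x)] with y hy
    obtain ⟨V, hV, hVU, hVc⟩ := hA y _ (inter_mem hy (hU y))
    obtain ⟨z₀, hz₀⟩ := hVc.nonempty
    refine ⟨k x z₀ * (k y z₀)⁻¹, mem_of_superset (preimage_mem_comap hV) fun z hz => ?_⟩
    obtain ⟨γ, hγ⟩ := hVc.joinedIn z₀ hz₀ z hz
    have h1 := (hk x γ.toContinuousMap fun t => (hVU (hγ t)).1).symm.trans
      (hk y γ.toContinuousMap fun t => (hVU (hγ t)).2)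
    simp only [Path.coe_toContinuousMap, Path.source, Path.target] at h1
    rw [inv_mul_eq_iff_eq_mul] at h1
    change k x z = _
    rw [h1, mul_assoc]
  have huniq {x y : X} {c d : G} (hc : C x y c) (hd : C x y d) : c = d := by
    have := hA.neBot y
    obtain ⟨z, h1, h2⟩ := (hc.and hd).exists
    exact mul_right_cancel (h1.symm.trans h2)
  let w (x y : X) : G := if h : ∃ c, C x y c then h.choose else 1
  have hw (x : X) : ∀ᶠ y in 𝓝 x, C x y (w x y) := (hex x).mono fun y hy => by
    simp only [w, dif_pos hy]
    exact hy.choose_spec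
  have hcocycle : IsLocalCocycle w := fun x => by
    filter_upwards [hw x, eventually_eventually_nhds.2 (hw x)] with y hxy hx
    have hxy' : ∀ᶠ z in 𝓝 y, ∀ᶠ z' : {z // z ∉ A} in comap (↑) (𝓝 z), k x z' = w x y * k y z' := by
      filter_upwards [eventually_eventually_nhds.2 (eventually_comap.1 hxy)] with z hz
      exact eventually_comap.2 hz
    filter_upwards [hx, hw y, hxy'] with z hxz hyz hxyz
    refine huniq hxz ?_
    filter_upwards [hyz, hxyz] with z' h1 h2
    rw [h2, h1, mul_assoc]
  obtain ⟨s, hs⟩ := hcocycle.exists_isLocalSection_of_primitive hX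
  refine ⟨fun p => s p * k p p, PathHom.isPrimitiveOn_of_locally fun p _ => ?_⟩
  refine ⟨(↑) ⁻¹' (U p ∩ {q | C p q (w p q) ∧ s q = s p * w p q}),
    continuous_subtype_val.continuousAt.preimage_mem_nhds
      (inter_mem (hU p) ((hw p).and (hs p))), fun γ h0 hγ => ?_⟩
  have hK (t : I) : s (γ t) * k (γ t) (γ t) = s p * k p (γ t) := by
    obtain ⟨⟨-, h1, h2⟩, -⟩ := hγ t
    change ∀ᶠ z in comap _ _, _ at h1
    rw [← nhds_subtype_eq_comap] at h1
    rw [h2, h1.self_of_nhds, mul_assoc]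
  rw [hK, hK, hk p γ fun t => (hγ t).1.1]
  group

end IsLocallyNonseparating

variable {k : ℕ} {J : OrientedLink k} {G : Type*}

theorem exists_isPrimitiveOn_of_notMem_carrier [Group G] (ψ : PathHom J.Complement G) {x : S3}
    (hx : x ∉ J.carrier) : ∃ U ∈ 𝓝 x, ∃ l, ψ.IsPrimitiveOn l ((↑) ⁻¹' U) := by
  obtain ⟨e, hxe⟩ : ∃ e : OpenPartialHomeomorph S3 (E 3), x ∈ e.source :=
    ⟨chartAt (E 3) x, mem_chart_source (E 3) x⟩
  have h1 : e.target ∩ e.symm ⁻¹' J.carrierᶜ ∈ 𝓝 (e x) :=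
    (e.isOpen_inter_preimage_symm J.isOpen_compl_carrier).mem_nhds
      ⟨e.map_source hxe, by rw [mem_preimage, e.left_inv hxe]; exact hx⟩
  obtain ⟨ε, hε, hb⟩ := Metric.mem_nhds_iff.1 h1
  let f : C(Metric.ball (e x) ε, J.Complement) := ⟨fun p => ⟨e.symm p, (hb p.2).2⟩,
    (e.continuousOn_symm.comp_continuous continuous_subtype_val fun p => (hb p.2).1).subtype_mk _⟩
  have : ContractibleSpace (Metric.ball (e x) ε) :=
    (convex_ball (e x) ε).contractibleSpace ⟨_, Metric.mem_ball_self hε⟩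
  obtain ⟨l, hl⟩ := (ψ.comap f).exists_primitive
  have hU : e.source ∩ e ⁻¹' Metric.ball (e x) ε ∈ 𝓝 x :=
    inter_mem (e.open_source.mem_nhds hxe)
      ((e.continuousAt hxe).preimage_mem_nhds (Metric.ball_mem_nhds _ hε))
  obtain ⟨l', hl'⟩ : ∃ l' : E 3 → G, ∀ p : Metric.ball (e x) ε, l' p = l p :=
    ⟨Function.extend Subtype.val l 1, Subtype.val_injective.extend_apply l 1⟩
  refine ⟨_, hU, fun z => l' (e z), fun γ hγ => ?_⟩
  have h2 := hl ⟨fun t => ⟨e (γ t), (hγ t).2⟩, (e.continuousOn.comp_continuous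
    (continuous_subtype_val.comp γ.continuous) fun t => (hγ t).1).subtype_mk _⟩ fun _ => trivial
  rw [← hl', ← hl'] at h2
  refine Eq.trans (congrArg ψ.toFun ?_) h2
  ext t : 1
  exact Subtype.ext (e.left_inv (hγ t).1).symm

namespace TubularNeighborhood

variable (N : TubularNeighborhood J)
include N

theorem isLocallyNonseparating_carrier : IsLocallyNonseparating J.carrier := fun x U hU => by
  by_cases hx : x ∈ J.carrier
  · obtain ⟨e, he⟩ := N.exists_isTubeChart ⟨x, hx⟩
    obtain ⟨η, hη⟩ := he.exists_slab
    obtain ⟨ε, hε, hεU⟩ := hη.exists_slab_subset hU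
    exact ⟨_, (IsSlabChart.isOpen_slab e x ε ε).mem_nhds hε.mem_slab, hεU, hε.isPathConnected_slab⟩
  · obtain ⟨V, ⟨hV, hVc⟩, hVU⟩ := (path_connected_basis x).mem_iff.1
      (inter_mem hU (J.isOpen_compl_carrier.mem_nhds hx))
    refine ⟨V, hV, fun z hz => (hVU hz).1, ?_⟩
    have h : Subtype.val '' (Subtype.val ⁻¹' V : Set J.Complement) = V := by
      rw [image_preimage_eq_inter_range, Subtype.range_coe_subtype]
      exact inter_eq_left.2 fun z hz => (hVU hz).2
    rwa [IsInducing.isPathConnected_iff (f := ((↑) : J.Complement → S3)) .subtypeVal, h]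

theorem pathConnectedSpace_exterior : PathConnectedSpace N.Exterior := by
  have : Nonempty S3 := ⟨⟨EuclideanSpace.single 0 1, by simp⟩⟩
  have := N.isLocallyNonseparating_carrier.pathConnectedSpace
  exact Function.Surjective.pathConnectedSpace
    (fun z => ⟨_, N.toExterior_toComplement z⟩) N.toExterior.continuous

/-- The fundamental group of the complement of a link is normally generated by the meridians; here,
only the consequence for homomorphisms to commutative groups. -/
theorem exists_primitive_of_meridian [CommGroup G] (ψ : PathHom J.Complement G)
    (h : ∀ x, ψ.toFun (N.toComplement.comp (N.meridian x).toContinuousMap) = 1) :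
    ∃ l, ψ.IsPrimitiveOn l univ := by
  refine N.isLocallyNonseparating_carrier.exists_primitive (fun ψ => S3.exists_primitive ψ) ψ
    fun x => ?_
  by_cases hx : x ∈ J.carrier
  · obtain ⟨e, he⟩ := N.exists_isTubeChart ⟨x, hx⟩
    obtain ⟨η, hη⟩ := he.exists_slab
    obtain ⟨c, hc, hc'⟩ := hη.exists_period ψ
    refine ⟨_, (IsSlabChart.isOpen_slab e x η 2).mem_nhds hη.mem_slab, hc' ?_⟩
    rw [← h ⟨x, hx⟩]
    exact (hc 1 one_pos one_lt_two _ fun t => N.meridian_apply_chart he t).symm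
  · exact exists_isPrimitiveOn_of_notMem_carrier ψ hx

/-- The image of the crossing homomorphism on a meridian under a homomorphism to a commutative
group. -/
theorem map_crossing_meridian {m : ℕ} {F : Fin m → OrientedSurface} [Group G] {g : Fin m → G}
    {Φ : PathHom J.Complement G} (hΦ : IsCrossingHom F g Φ)
    (hF : Pairwise fun i j => Disjoint (F i).carrier (F j).carrier)
    (hFJ : ∀ i, (F i).boundary ⊆ J.carrier)
    (hor : ∀ i e, (F i).IsChart e → ∀ y : J.carrier, (y : S3) ∈ e.source →
      e y 1 = 0 → e y 2 = 0 → ∃ c : ℝ, 0 < c ∧ coordVec e (e y) 0 = c • J.tangent y)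
    {i : Fin m} {x : J.carrier} (hx : (x : S3) ∈ (F i).boundary) {H : Type*} [CommGroup H]
    (f : G →* H) :
    f (Φ.toFun (N.toComplement.comp (N.meridian x).toContinuousMap)) = f (g i) := by
  obtain ⟨e, he⟩ := N.exists_isTubeChart x
  obtain ⟨η, hη⟩ := he.exists_slab
  obtain ⟨c, hc, -⟩ := hη.exists_period (Φ.mapHom f)
  obtain ⟨r₀, hr₀, hsmall⟩ := hΦ.small_meridian hF hFJ hor hx he.isChart he.mem_source
  obtain ⟨r, hr, hrr⟩ := exists_between (lt_min hr₀ two_pos)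
  obtain ⟨hr1, hr2⟩ := lt_min_iff.1 hrr
  obtain ⟨γ, hγ⟩ := hη.exists_circle hr hr2
  have h1 := hc 1 one_pos one_lt_two (N.toComplement.comp (N.meridian x).toContinuousMap)
    fun t => N.meridian_apply_chart he t
  have h2 := hc r hr hr2 γ hγ
  rw [← hsmall r hr hr1 γ hγ]
  exact h1.trans h2.symm

end TubularNeighborhood

end Complement

theorem transcendental_ratFunc_X :
    @Transcendental ℤ (RatFunc ℚ) _ _ (Ring.toIntAlgebra _) RatFunc.X := by
  rintro ⟨p, hp, h⟩
  refine RatFunc.transcendental_X (K := ℚ) ⟨p.map (Int.castRingHom ℚ),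
    (Polynomial.map_ne_zero_iff (Int.castRingHom ℚ).injective_int).2 hp, ?_⟩
  refine Eq.trans (Polynomial.eval₂_map _ _ _) (Eq.trans ?_ h)
  exact congrArg (fun f : ℤ →+* RatFunc ℚ => p.eval₂ f RatFunc.X) (RingHom.ext_int _ _)

end WeaklySplitLinks

end

open WeaklySplitLinks in
theorem mainTheorem3 {k : ℕ} (J : OrientedLink k) (m : ℕ) (hJ : J.IsWeaklySplit m)
    (N : TubularNeighborhood J) :
    (∃ φ : GroupoidHom N.Exterior, N.IsCanonical φ) ∧
      ∀ φ : GroupoidHom N.Exterior, N.IsCanonical φ →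
        (m : Cardinal.{0}) ≤ N.linkRank φ + 1 := by
  obtain ⟨F, hF, hne, hbd, hor⟩ := hJ
  have hFJ : ∀ i, (F i).boundary ⊆ J.carrier := fun i => hbd ▸ Set.subset_iUnion (fun i => (F i).boundary) i
  obtain ⟨Φ, hΦ⟩ := exists_isCrossingHom hF hFJ (FreeGroup.of : Fin m → FreeGroup (Fin m))
  have hmer {i : Fin m} {x : J.carrier} (hx : (x : S3) ∈ (F i).boundary) {H : Type}
      [CommGroup H] (f : FreeGroup (Fin m) →* H) :
      f (Φ.toFun (N.toComplement.comp (N.meridian x).toContinuousMap)) = f (.of i) :=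
    N.map_crossing_meridian hΦ hF hFJ hor hx f
  have hdeg (x : J.carrier) : totalDegree (Fin m)
      (Φ.toFun (N.toComplement.comp (N.meridian x).toContinuousMap)) = Multiplicative.ofAdd 1 := by
    obtain ⟨i, hi⟩ := Set.mem_iUnion.1 (hbd.symm ▸ x.2 : (x : S3) ∈ ⋃ i, (F i).boundary)
    rw [hmer hi, totalDegree, FreeGroup.lift_apply_of]
  refine ⟨⟨((Φ.comap N.toComplement).mapHom (totalDegree (Fin m))).toGroupoidHom, fun x => ?_⟩,
    fun φ hφ => ?_⟩
  · rw [PathHom.eval_toGroupoidHom]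
    exact congrArg Multiplicative.toAdd (hdeg x)
  obtain _ | n := m
  · simp
  have hφmer (x : J.carrier) : φ.toPathHom.toFun (N.meridian x).toContinuousMap =
      Multiplicative.ofAdd 1 := by
    rw [GroupoidHom.toPathHom_apply, hφ x]
  have hcancel (γ : C(unitInterval, N.Exterior)) :
      N.toExterior.comp (N.toComplement.comp γ) = γ :=
    ContinuousMap.ext fun t => N.toExterior_toComplement (γ t)
  -- `φ` and the total crossing number agree on meridians, hence differ by a coboundary
  obtain ⟨l, hl⟩ := N.exists_primitive_of_meridian
    ((φ.toPathHom.comap N.toExterior).div (Φ.mapHom (totalDegree (Fin (n + 1))))) fun x => by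
      change φ.toPathHom.toFun (N.toExterior.comp (N.toComplement.comp _)) /
        totalDegree _ (Φ.toFun _) = 1
      rw [hcancel, hφmer, hdeg, div_self']
  choose p hp using hne
  have := N.pathConnectedSpace_exterior
  have hrank := le_twistedRank_of_freeGroup (Units.mk0 (RatFunc.X : RatFunc ℚ) RatFunc.X_ne_zero)
    transcendental_ratFunc_X (Φ.comap N.toComplement) (fun z => l (N.toComplement z))
    (fun γ => by
      have h1 := hl (N.toComplement.comp γ) fun _ => trivial
      change φ.toPathHom.toFun (N.toExterior.comp (N.toComplement.comp γ)) /
        totalDegree _ (Φ.toFun _) = _ at h1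
      rw [hcancel, div_eq_iff_eq_mul'] at h1
      exact h1)
    (fun i => N.meridianPoint ⟨p i, hFJ i (hp i)⟩) (fun i => N.meridian ⟨p i, hFJ i (hp i)⟩)
    (fun i => hφ _)
    (fun i j => by
      refine (hmer (hp i) (exponent j)).trans ?_
      rw [exponent, FreeGroup.lift_apply_of])
  push_cast
  exact add_le_add_left hrank 1
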